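/- Let $w$ be one of the four Chebyshev weights $w_1(x)=\frac{1}{\sqrt{1-x^2}}$, $w_2(x)=\sqrt{1-x^2}$, $w_3(x)=\sqrt{\frac{1+x}{1-x}}$, $w_4(x)=\sqrt{\frac{1-x}{1+x}}$ on $(-1,1)$, and let $p_n(w,\cdot)$, $n\ge 0$, be the polynomials of degree $n$ with positive leading coefficient that are orthonormal with respect to $w$. For $n\ge 1$ let $x_k=\cos t_k$, $k=1,\dots,n$, be the zeros of $p_n(w,\cdot)$, where $t_k=\frac{(2k-1)\pi}{2n},\ \frac{k\pi}{n+1},\ \frac{(2k-1)\pi}{2n+1},\ \frac{2k\pi}{2n+1}$ for $w=w_1,w_2,w_3,w_4$ respectively, and let $\lambda_{n,k}=\bigl(\sum_{j=0}^{n}p_j(w,x_k)^2\bigr)^{-1}$. For integers $0<m<n$ put $\mu_{n,j}^m=1$ if $0\le j\le n-m$ and $\mu_{n,j}^m=\frac{n+m-j}{2m}$ if $n-m<j<n+m$, and define the de la Vallée Poussin (VP) interpolation polynomial of a function $f$ by $$V_n^mf(x)=\sum_{k=1}^n f(x_k)\,\lambda_{n,k}\sum_{j=0}^{n+m-1}\mu_{n,j}^m\,p_j(w,x_k)\,p_j(w,x).$$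 Let $u(x)=(1-x)^\gamma(1+x)^\delta$, let $\|g\|=\sup_{|x|\le 1}|g(x)|\in[0,\infty]$, and let $E_N(f)_u=\inf_P\|(f-P)u\|$, the infimum over all real polynomials $P$ of degree at most $N$. Assume that the real exponents $\gamma,\delta$ satisfy - $0\le\gamma\le1$ and $0\le\delta\le1$, if $w=w_1$; - $0<\gamma\le\frac32$, $0<\delta\le\frac32$ and $-1\le\gamma-\delta\le1$, if $w=w_2$; - $0\le\gamma\le1$, $0<\delta\le\frac32$ and $\gamma-\delta\le\frac12$, if $w=w_3$; - $0<\gamma\le\frac32$, $0\le\delta\le1$ and $\gamma-\delta\ge-\frac12$, if $w=w_4$. Then for every constant $c>1$ there is a constant $\mathcal C>0$ (depending only on $w,\gamma,\delta,c$) such that for all integers $n,m$ with $m<n\le c\,m$ and every real function $f$, defined on $(-1,1)$ and at those endpoints $\pm1$ at which $u$ does not vanish, such that $f(x)u(x)\to0$ as $x\to1$ if $u(1)=0$ and as $x\to-1$ if $u(-1)=0$ (the function $fu$ being taken as $0$ at these endpoints), we have $$E_{n+m-1}(f)_u\ \le\ \|(f-V_n^mf)u\|\ \le\ \mathcal C\,E_{n-m}(f)_u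 .$$ -/

import Mathlib

open Real Polynomial Filter Topology
open scoped ENNReal NNReal

/-- Labels for the four Chebyshev weights. -/
inductive ChebKind
  | w1
  | w2
  | w3
  | w4

namespace ChebKind

/-- The four Chebyshev weights on the interval from `-1` to `1`. -/
noncomputable def weight : ChebKind → ℝ → ℝ
  | w1, x => 1 / √(1 - x ^ 2)
  | w2, x => √(1 - x ^ 2)
  | w3, x => √((1 + x) / (1 - x))
  | w4, x => √((1 - x) / (1 + x))

/-- The orthonormal polynomials `p_n(w, ·)` with positive leading coefficients: the normalized
Chebyshev polynomials of the first, second, third and fourth kind. That this is the orthonormal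
system of the weight is proved in `orthoPoly_isOrthonormal`. -/
noncomputable def orthoPoly : ChebKind → ℕ → ℝ[X]
  | w1, n => Polynomial.C (if n = 0 then 1 / √π else √(2 / π)) * Chebyshev.T ℝ n
  | w2, n => Polynomial.C (√(2 / π)) * Chebyshev.U ℝ n
  | w3, n => Polynomial.C (1 / √π) * (Chebyshev.U ℝ n - Chebyshev.U ℝ ((n : ℤ) - 1))
  | w4, n => Polynomial.C (1 / √π) * (Chebyshev.U ℝ n + Chebyshev.U ℝ ((n : ℤ) - 1))

/-- The angles `t_k` (`k = 1, …, n`). -/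
noncomputable def angle : ChebKind → ℕ → ℕ → ℝ
  | w1, n, k => (2 * (k : ℝ) - 1) * π / (2 * n)
  | w2, n, k => (k : ℝ) * π / (n + 1)
  | w3, n, k => (2 * (k : ℝ) - 1) * π / (2 * n + 1)
  | w4, n, k => 2 * (k : ℝ) * π / (2 * n + 1)

/-- The nodes `x_k = cos t_k` (`k = 1, …, n`), the zeros of `p_n(w, ·)`
(see `orthoPoly_eval_node`, `node_injOn`). -/
noncomputable def node (w : ChebKind) (n k : ℕ) : ℝ := cos (w.angle n k)

/-- The Christoffel numbers `λ_{n,k} = 1 / ∑_{j=0}^{n} p_j(w, x_k)^2`. -/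
noncomputable def christoffel (w : ChebKind) (n k : ℕ) : ℝ :=
  1 / ∑ j ∈ Finset.range (n + 1), ((w.orthoPoly j).eval (w.node n k)) ^ 2

/-- `p` is the system of orthonormal polynomials with positive leading coefficients of the
weight `w` on the interval from `-1` to `1`. -/
structure IsOrthonormalSystem (w : ℝ → ℝ) (p : ℕ → ℝ[X]) : Prop where
  natDegree_eq : ∀ n, (p n).natDegree = n
  leadingCoeff_pos : ∀ n, 0 < (p n).leadingCoeff
  integral_eq : ∀ i j,
    ∫ x in (-1 : ℝ)..1, (p i).eval x * (p j).eval x * w x = if i = j then 1 else 0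

end ChebKind

/-- The de la Vallée Poussin filter coefficients `μ_{n,j}^m`, for `j < n + m`. -/
noncomputable def vpFilter (n m j : ℕ) : ℝ :=
  if j ≤ n - m then 1 else ((n : ℝ) + m - j) / (2 * m)

/-- The fundamental VP polynomials `Φ_{n,k}^m`. -/
noncomputable def vpFundamental (w : ChebKind) (n m k : ℕ) : ℝ[X] :=
  Polynomial.C (w.christoffel n k) * ∑ j ∈ Finset.range (n + m),
    Polynomial.C (vpFilter n m j * (w.orthoPoly j).eval (w.node n k)) * w.orthoPoly j

/-- The VP interpolation polynomial `V_n^m f`. -/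
noncomputable def vpInterp (w : ChebKind) (n m : ℕ) (f : ℝ → ℝ) : ℝ[X] :=
  ∑ k ∈ Finset.Icc 1 n, Polynomial.C (f (w.node n k)) * vpFundamental w n m k

/-- The Jacobi weight `u(x) = (1 - x)^γ (1 + x)^δ`. -/
noncomputable def jacobiWeight (γ δ x : ℝ) : ℝ := (1 - x) ^ γ * (1 + x) ^ δ

/-- `‖g‖ = sup_{|x| ≤ 1} |g x|`, with value `∞` if `g` is unbounded there. -/
noncomputable def supNorm (g : ℝ → ℝ) : ℝ≥0∞ :=
  ⨆ x ∈ Set.Icc (-1 : ℝ) 1, ENNReal.ofReal |g x|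

/-- The weighted error `‖(f - P) u‖`. -/
noncomputable def weightedError (γ δ : ℝ) (f : ℝ → ℝ) (P : ℝ[X]) : ℝ≥0∞ :=
  supNorm fun x => (f x - P.eval x) * jacobiWeight γ δ x

/-- The error `E_N(f)_u` of best weighted approximation by polynomials of degree at most `N`. -/
noncomputable def bestError (γ δ : ℝ) (f : ℝ → ℝ) (N : ℕ) : ℝ≥0∞ :=
  ⨅ (P : ℝ[X]) (_ : P.natDegree ≤ N), weightedError γ δ f P

/-- The class of functions under consideration: `f u` tends to `0` at every endpoint of the
interval from `-1` to `1` at which `u` vanishes. -/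
def VanishesAtZerosOfWeight (γ δ : ℝ) (f : ℝ → ℝ) : Prop :=
  (jacobiWeight γ δ 1 = 0 → Tendsto (fun x => f x * jacobiWeight γ δ x) (𝓝[<] 1) (𝓝 0)) ∧
  (jacobiWeight γ δ (-1) = 0 → Tendsto (fun x => f x * jacobiWeight γ δ x) (𝓝[>] (-1)) (𝓝 0))

/-- The bounds on the exponents of the Jacobi weight, for each Chebyshev weight. -/
def ExponentBounds : ChebKind → ℝ → ℝ → Prop
  | .w1, γ, δ => 0 ≤ γ ∧ γ ≤ 1 ∧ 0 ≤ δ ∧ δ ≤ 1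
  | .w2, γ, δ => 0 < γ ∧ γ ≤ 3 / 2 ∧ 0 < δ ∧ δ ≤ 3 / 2 ∧ -1 ≤ γ - δ ∧ γ - δ ≤ 1
  | .w3, γ, δ => 0 ≤ γ ∧ γ ≤ 1 ∧ 0 < δ ∧ δ ≤ 3 / 2 ∧ γ - δ ≤ 1 / 2
  | .w4, γ, δ => 0 < γ ∧ γ ≤ 3 / 2 ∧ 0 ≤ δ ∧ δ ≤ 1 ∧ -(1 / 2) ≤ γ - δ

namespace ChebKind

theorem weight_eq_w3 {x : ℝ} (hx : x ∈ Set.Icc (-1 : ℝ) 1) :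
    √((1 + x) / (1 - x)) = (1 + x) * √(1 - x ^ 2)⁻¹ := by
  obtain ⟨h1, h2⟩ := hx
  rcases eq_or_lt_of_le h1 with rfl | h1
  · simp
  rcases eq_or_lt_of_le h2 with rfl | h2
  · simp
  have e : (1 + x) / (1 - x) = (1 + x) ^ 2 * (1 - x ^ 2)⁻¹ := by
    have : 1 - x ≠ 0 := by linarith
    have : 1 + x ≠ 0 := by linarith
    have : 1 - x ^ 2 ≠ 0 := by nlinarith
    field_simp
    ring
  rw [e, sqrt_mul (sq_nonneg _), sqrt_sq (by linarith)]

theorem weight_eq_w4 {x : ℝ} (hx : x ∈ Set.Icc (-1 : ℝ) 1) :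
    √((1 - x) / (1 + x)) = (1 - x) * √(1 - x ^ 2)⁻¹ := by
  have := weight_eq_w3 (x := -x) ⟨by linarith [hx.2], by linarith [hx.1]⟩
  simpa [sub_eq_add_neg] using this

theorem weight_eq_w2 {x : ℝ} (hx : x ∈ Set.Icc (-1 : ℝ) 1) :
    √(1 - x ^ 2) = (1 - x ^ 2) * √(1 - x ^ 2)⁻¹ := by
  have h : 0 ≤ 1 - x ^ 2 := by nlinarith [hx.1, hx.2]
  rw [sqrt_inv]
  rcases eq_or_lt_of_le h with h | h
  · simp [← h]
  · have := sqrt_pos.2 h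
    field_simp
    rw [sq_sqrt h.le]

/-- The weight relative to the first one. -/
noncomputable def factor : ChebKind → ℝ → ℝ
  | w1, _ => 1
  | w2, x => 1 - x ^ 2
  | w3, x => 1 + x
  | w4, x => 1 - x

theorem integral_mul_weight (w : ChebKind) (g : ℝ → ℝ) :
    ∫ x in (-1 : ℝ)..1, g x * w.weight x =
      ∫ θ in (0 : ℝ)..π, g (cos θ) * w.factor (cos θ) := by
  rw [← Chebyshev.integral_measureT_eq_integral_cos (f := fun x => g x * w.factor x),
    Chebyshev.integral_measureT]
  refine intervalIntegral.integral_congr fun x hx => ?_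
  rw [Set.uIcc_of_le (by norm_num)] at hx
  cases w
  · simp [weight, factor]
  · simp only [weight, factor]; rw [weight_eq_w2 hx]; ring
  · simp only [weight, factor]; rw [weight_eq_w3 hx]; ring
  · simp only [weight, factor]; rw [weight_eq_w4 hx]; ring

theorem integral_cos_int (n : ℤ) :
    ∫ θ in (0 : ℝ)..π, cos (n * θ) = if n = 0 then π else 0 := by
  have h := Chebyshev.integral_measureT_eq_integral_cos (f := fun x => (Chebyshev.T ℝ n).eval x)
  simp only [Chebyshev.T_real_cos] at h
  rw [← h]
  split_ifs with hn
  · subst hn; exact Chebyshev.integral_eval_T_real_measureT_zero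
  · exact Chebyshev.integral_eval_T_real_measureT_of_ne_zero hn

theorem eval_third_mul (n : ℤ) (θ : ℝ) (h : sin (θ / 2) ≠ 0) :
    (Chebyshev.U ℝ n - Chebyshev.U ℝ (n - 1)).eval (cos θ) * cos (θ / 2) =
      cos ((2 * n + 1) * θ / 2) := by
  have h1 := Chebyshev.U_real_cos θ n
  have h2 := Chebyshev.U_real_cos θ (n - 1)
  have h3 : sin θ = 2 * sin (θ / 2) * cos (θ / 2) := by
    rw [← sin_two_mul]; ring_nf
  have h4 : sin ((n + 1) * θ) - sin (n * θ) = 2 * sin (θ / 2) * cos ((2 * n + 1) * θ / 2) := by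
    rw [sin_sub_sin]; ring_nf
  have h5 : (((n - 1 : ℤ) : ℝ) + 1) = n := by push_cast; ring
  rw [h5] at h2
  rw [← h1, ← h2, h3] at h4
  rw [eval_sub]
  refine mul_left_cancel₀ (mul_ne_zero two_ne_zero h) ?_
  linear_combination h4

theorem eval_fourth_mul (n : ℤ) (θ : ℝ) (h : cos (θ / 2) ≠ 0) :
    (Chebyshev.U ℝ n + Chebyshev.U ℝ (n - 1)).eval (cos θ) * sin (θ / 2) =
      sin ((2 * n + 1) * θ / 2) := by
  have h1 := Chebyshev.U_real_cos θ n
  have h2 := Chebyshev.U_real_cos θ (n - 1)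
  have h3 : sin θ = 2 * sin (θ / 2) * cos (θ / 2) := by
    rw [← sin_two_mul]; ring_nf
  have h4 : sin ((n + 1) * θ) + sin (n * θ) = 2 * sin ((2 * n + 1) * θ / 2) * cos (θ / 2) := by
    have := sin_sub_sin ((n + 1) * θ) (-(n * θ))
    rw [sin_neg, sub_neg_eq_add] at this
    rw [this]; ring_nf
  have h5 : (((n - 1 : ℤ) : ℝ) + 1) = n := by push_cast; ring
  rw [h5] at h2
  rw [← h1, ← h2, h3] at h4
  rw [eval_add]
  refine mul_left_cancel₀ (mul_ne_zero two_ne_zero h) ?_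
  linear_combination h4

theorem integral_cos_add_cos (a b s : ℝ) (i j : ℤ) :
    ∫ θ in (0 : ℝ)..π, s * (a * cos (i * θ) + b * cos (j * θ)) =
      s * (a * (if i = 0 then π else 0) + b * (if j = 0 then π else 0)) := by
  rw [intervalIntegral.integral_const_mul, intervalIntegral.integral_add,
    intervalIntegral.integral_const_mul, intervalIntegral.integral_const_mul,
    integral_cos_int, integral_cos_int]
  all_goals exact Continuous.intervalIntegrable (by fun_prop) _ _

theorem orthoPoly_integral (w : ChebKind) (i j : ℕ) :
    ∫ x in (-1 : ℝ)..1, (w.orthoPoly i).eval x * (w.orthoPoly j).eval x * w.weight x =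
      if i = j then 1 else 0 := by
  rw [integral_mul_weight w fun x => (w.orthoPoly i).eval x * (w.orthoPoly j).eval x]
  have hpi := pi_pos
  have hs : √π * √π = π := mul_self_sqrt hpi.le
  have hs0 : √π ≠ 0 := (sqrt_pos.2 hpi).ne'
  have hs2 : √(2 / π) * √(2 / π) = 2 / π := mul_self_sqrt (by positivity)
  have hs3 : 1 / √π * (1 / √π) = 1 / π := by rw [div_mul_div_comm, hs, one_mul]
  have hij : ((i : ℤ) - j = 0) ↔ i = j := by omega
  have hae : ∀ f g : ℝ → ℝ, (∀ θ ∈ Set.Ioo 0 π, f θ = g θ) →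
      ∫ θ in (0 : ℝ)..π, f θ = ∫ θ in (0 : ℝ)..π, g θ := by
    intro f g h
    rw [intervalIntegral.integral_of_le hpi.le, intervalIntegral.integral_of_le hpi.le,
      MeasureTheory.integral_Ioc_eq_integral_Ioo, MeasureTheory.integral_Ioc_eq_integral_Ioo]
    exact MeasureTheory.setIntegral_congr_fun measurableSet_Ioo h
  cases w
  · set a : ℕ → ℝ := fun n => if n = 0 then 1 / √π else √(2 / π) with ha
    rw [hae _ (fun θ => (a i * a j / 2) *
      (1 * cos (((i - j : ℤ) : ℝ) * θ) + 1 * cos (((i + j : ℤ) : ℝ) * θ)))]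
    · rw [integral_cos_add_cos]
      by_cases h : i = j
      · subst h
        by_cases h0 : i = 0
        · subst h0
          simp only [ha, if_true, hs3]
          simp
          field_simp
          norm_num
        · have : (i : ℤ) + i ≠ 0 := by omega
          simp only [ha, h0, if_false, hs2, this]
          simp
          field_simp
      · have : (i : ℤ) + j ≠ 0 := by omega
        simp [hij, h, this]
    · intro θ _
      simp only [orthoPoly, factor, eval_mul, eval_C, Chebyshev.T_real_cos]
      have e : ∀ x y : ℝ, cos (x - y) + cos (x + y) = 2 * cos x * cos y := by
        intro x y; rw [cos_sub, cos_add]; ring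
      have := e (i * θ) (j * θ)
      push_cast
      rw [sub_mul, add_mul, one_mul, one_mul, this]
      simp only [ha]
      ring
  · rw [hae _ (fun θ => (√(2 / π) * √(2 / π) / 2) *
      (1 * cos (((i - j : ℤ) : ℝ) * θ) + (-1) * cos (((i + j + 2 : ℤ) : ℝ) * θ)))]
    · rw [integral_cos_add_cos, hs2]
      have : (i : ℤ) + j + 2 ≠ 0 := by omega
      simp only [hij, this, if_false]
      split_ifs
      · field_simp; ring
      · ring
    · intro θ _
      simp only [orthoPoly, factor, eval_mul, eval_C]
      have h1 := Chebyshev.U_real_cos θ i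
      have h2 := Chebyshev.U_real_cos θ j
      have e : ∀ x y : ℝ, 1 * cos (x - y) + (-1) * cos (x + y) = 2 * sin x * sin y := by
        intro x y; rw [cos_sub, cos_add]; ring
      have h3 := e ((i + 1) * θ) ((j + 1) * θ)
      have e1 : (((i - j : ℤ) : ℝ) * θ) = (i + 1) * θ - (j + 1) * θ := by push_cast; ring
      have e2 : (((i + j + 2 : ℤ) : ℝ) * θ) = (i + 1) * θ + (j + 1) * θ := by push_cast; ring
      push_cast at h1 h2
      rw [e1, e2, h3, ← h1, ← h2, ← sin_sq]
      ring
  · rw [hae _ (fun θ => (1 / √π * (1 / √π)) *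
      (1 * cos (((i - j : ℤ) : ℝ) * θ) + 1 * cos (((i + j + 1 : ℤ) : ℝ) * θ)))]
    · rw [integral_cos_add_cos, hs3]
      have : (i : ℤ) + j + 1 ≠ 0 := by omega
      simp only [hij, this, if_false]
      split_ifs
      · field_simp; ring
      · ring
    · intro θ hθ
      have hne : sin (θ / 2) ≠ 0 :=
        (sin_pos_of_pos_of_lt_pi (by linarith [hθ.1]) (by linarith [hθ.1, hθ.2])).ne'
      simp only [orthoPoly, factor, eval_mul, eval_C]
      have h1 := eval_third_mul i θ hne
      have h2 := eval_third_mul j θ hne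
      have e : ∀ x y : ℝ, 1 * cos (x - y) + 1 * cos (x + y) = 2 * cos x * cos y := by
        intro x y; rw [cos_sub, cos_add]; ring
      have h3 := e ((2 * (i : ℝ) + 1) * θ / 2) ((2 * (j : ℝ) + 1) * θ / 2)
      have e1 : (((i - j : ℤ) : ℝ) * θ) =
        (2 * (i : ℝ) + 1) * θ / 2 - (2 * (j : ℝ) + 1) * θ / 2 := by push_cast; ring
      have e2 : (((i + j + 1 : ℤ) : ℝ) * θ) =
        (2 * (i : ℝ) + 1) * θ / 2 + (2 * (j : ℝ) + 1) * θ / 2 := by push_cast; ring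
      have e3 : 1 + cos θ = 2 * cos (θ / 2) ^ 2 := by
        rw [cos_sq]; ring_nf
      push_cast at h1 h2
      rw [e1, e2, h3, ← h1, ← h2, e3]
      ring
  · rw [hae _ (fun θ => (1 / √π * (1 / √π)) *
      (1 * cos (((i - j : ℤ) : ℝ) * θ) + (-1) * cos (((i + j + 1 : ℤ) : ℝ) * θ)))]
    · rw [integral_cos_add_cos, hs3]
      have : (i : ℤ) + j + 1 ≠ 0 := by omega
      simp only [hij, this, if_false]
      split_ifs
      · field_simp; ring
      · ring
    · intro θ hθ
      have hne : cos (θ / 2) ≠ 0 :=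
        (cos_pos_of_mem_Ioo ⟨by linarith [hθ.1], by linarith [hθ.2]⟩).ne'
      simp only [orthoPoly, factor, eval_mul, eval_C]
      have h1 := eval_fourth_mul i θ hne
      have h2 := eval_fourth_mul j θ hne
      have e : ∀ x y : ℝ, 1 * cos (x - y) + (-1) * cos (x + y) = 2 * sin x * sin y := by
        intro x y; rw [cos_sub, cos_add]; ring
      have h3 := e ((2 * (i : ℝ) + 1) * θ / 2) ((2 * (j : ℝ) + 1) * θ / 2)
      have e1 : (((i - j : ℤ) : ℝ) * θ) =
        (2 * (i : ℝ) + 1) * θ / 2 - (2 * (j : ℝ) + 1) * θ / 2 := by push_cast; ring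
      have e2 : (((i + j + 1 : ℤ) : ℝ) * θ) =
        (2 * (i : ℝ) + 1) * θ / 2 + (2 * (j : ℝ) + 1) * θ / 2 := by push_cast; ring
      have e3 : 1 - cos θ = 2 * sin (θ / 2) ^ 2 := by
        rw [sin_sq, cos_sq]; ring_nf
      push_cast at h1 h2
      rw [e1, e2, h3, ← h1, ← h2, e3]
      ring

theorem natDegree_U_sub_one_lt {n : ℕ} (hn : n ≠ 0) :
    (Chebyshev.U ℝ ((n : ℤ) - 1)).degree < (Chebyshev.U ℝ n).degree := by
  have : ((n : ℤ) - 1) = ((n - 1 : ℕ) : ℤ) := by omega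
  rw [this, Chebyshev.degree_U_natCast, Chebyshev.degree_U_natCast]
  exact_mod_cast (by omega : n - 1 < n)

theorem degree_U_sub_one_lt (n : ℕ) :
    (Chebyshev.U ℝ ((n : ℤ) - 1)).degree < (Chebyshev.U ℝ n).degree := by
  rcases eq_or_ne n 0 with rfl | hn
  · simp
  · exact natDegree_U_sub_one_lt hn

/-- `orthoPoly` is the system of orthonormal polynomials of the weight. -/
theorem orthoPoly_isOrthonormal (w : ChebKind) : IsOrthonormalSystem w.weight w.orthoPoly := by
  have hpi := pi_pos
  have h1 : 0 < √(2 / π) := sqrt_pos.2 (by positivity)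
  have h2 : 0 < 1 / √π := by positivity
  have h3 : ∀ n : ℕ, 0 < (if n = 0 then 1 / √π else √(2 / π)) := by
    intro n; split_ifs <;> assumption
  refine ⟨fun n => ?_, fun n => ?_, w.orthoPoly_integral⟩
  · cases w
    · rw [orthoPoly, natDegree_C_mul (h3 n).ne', Chebyshev.natDegree_T, Int.natAbs_natCast]
    · rw [orthoPoly, natDegree_C_mul h1.ne', Chebyshev.natDegree_U_natCast]
    · rw [orthoPoly, natDegree_C_mul h2.ne',
        natDegree_eq_of_degree_eq (degree_sub_eq_left_of_degree_lt (degree_U_sub_one_lt n)),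
        Chebyshev.natDegree_U_natCast]
    · rw [orthoPoly, natDegree_C_mul h2.ne',
        natDegree_eq_of_degree_eq (degree_add_eq_left_of_degree_lt (degree_U_sub_one_lt n)),
        Chebyshev.natDegree_U_natCast]
  · have hU : 0 < (Chebyshev.U ℝ (n : ℤ)).leadingCoeff := by
      rw [Chebyshev.leadingCoeff_U_natCast]; positivity
    cases w
    · rw [orthoPoly, leadingCoeff_mul, leadingCoeff_C, Chebyshev.leadingCoeff_T]
      exact mul_pos (h3 n) (by positivity)
    · rw [orthoPoly, leadingCoeff_mul, leadingCoeff_C]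
      exact mul_pos h1 hU
    · rw [orthoPoly, leadingCoeff_mul, leadingCoeff_C,
        leadingCoeff_sub_of_degree_lt (degree_U_sub_one_lt n)]
      exact mul_pos h2 hU
    · rw [orthoPoly, leadingCoeff_mul, leadingCoeff_C,
        leadingCoeff_add_of_degree_lt' (degree_U_sub_one_lt n)]
      exact mul_pos h2 hU

theorem angle_mem (w : ChebKind) {n k : ℕ} (hk : k ∈ Finset.Icc 1 n) :
    w.angle n k ∈ Set.Ioo 0 π := by
  have hpi := pi_pos
  obtain ⟨h1, h2⟩ := Finset.mem_Icc.1 hk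
  have h1' : (1 : ℝ) ≤ k := by exact_mod_cast h1
  have h2' : (k : ℝ) ≤ n := by exact_mod_cast h2
  cases w <;> simp only [angle] <;> constructor
  case w1.left => exact div_pos (mul_pos (by linarith) hpi) (by linarith)
  case w1.right => rw [div_lt_iff₀ (by linarith)]; nlinarith
  case w2.left => exact div_pos (mul_pos (by linarith) hpi) (by linarith)
  case w2.right => rw [div_lt_iff₀ (by linarith)]; nlinarith
  case w3.left => exact div_pos (mul_pos (by linarith) hpi) (by linarith)
  case w3.right => rw [div_lt_iff₀ (by linarith)]; nlinarith
  case w4.left => exact div_pos (mul_pos (by linarith) hpi) (by linarith)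
  case w4.right => rw [div_lt_iff₀ (by linarith)]; nlinarith

/-- The nodes are zeros of `p_n(w, ·)`. -/
theorem orthoPoly_eval_node (w : ChebKind) {n k : ℕ} (hk : k ∈ Finset.Icc 1 n) :
    (w.orthoPoly n).eval (w.node n k) = 0 := by
  have hθ := w.angle_mem hk
  have hpi := pi_pos
  have hn : (0 : ℝ) < n := by
    have := Finset.mem_Icc.1 hk
    exact_mod_cast (by omega : 0 < n)
  have hcos : cos (k * π - π / 2) = 0 := by
    rw [cos_sub_pi_div_two]; exact sin_nat_mul_pi k
  have hs : sin (w.angle n k / 2) ≠ 0 :=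
    (sin_pos_of_pos_of_lt_pi (by linarith [hθ.1]) (by linarith [hθ.1, hθ.2])).ne'
  have hc : cos (w.angle n k / 2) ≠ 0 :=
    (cos_pos_of_mem_Ioo ⟨by linarith [hθ.1], by linarith [hθ.2]⟩).ne'
  have hss : sin (w.angle n k) ≠ 0 := (sin_pos_of_pos_of_lt_pi hθ.1 hθ.2).ne'
  rw [node]
  cases w
  · have e : ((n : ℤ) : ℝ) * angle w1 n k = k * π - π / 2 := by
      simp only [angle]; push_cast; field_simp
    rw [orthoPoly, eval_mul, Chebyshev.T_real_cos, e, hcos, mul_zero]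
  · have e : (((n : ℤ) : ℝ) + 1) * angle w2 n k = k * π := by
      simp only [angle]; push_cast; field_simp
    have := Chebyshev.U_real_cos (angle w2 n k) n
    rw [e, sin_nat_mul_pi] at this
    rw [orthoPoly, eval_mul, (mul_eq_zero.1 this).resolve_right hss, mul_zero]
  · have e : (2 * ((n : ℤ) : ℝ) + 1) * angle w3 n k / 2 = k * π - π / 2 := by
      simp only [angle]; push_cast; field_simp
    have := eval_third_mul n _ hs
    rw [e, hcos] at this
    rw [orthoPoly, eval_mul, (mul_eq_zero.1 this).resolve_right hc, mul_zero]
  · have e : (2 * ((n : ℤ) : ℝ) + 1) * angle w4 n k / 2 = k * π := by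
      simp only [angle]; push_cast; field_simp
    have := eval_fourth_mul n _ hc
    rw [e, sin_nat_mul_pi] at this
    rw [orthoPoly, eval_mul, (mul_eq_zero.1 this).resolve_right hs, mul_zero]

/-- The `n` nodes are distinct. -/
theorem node_injOn (w : ChebKind) (n : ℕ) :
    Set.InjOn (w.node n) (Finset.Icc 1 n : Finset ℕ) := by
  intro k hk l hl h
  have hpi := pi_pos
  have hn : (0 : ℝ) < n := by
    have := Finset.mem_Icc.1 (Finset.mem_coe.1 hk)
    exact_mod_cast (by omega : 0 < n)
  have := injOn_cos (Set.Ioo_subset_Icc_self (w.angle_mem hk))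
    (Set.Ioo_subset_Icc_self (w.angle_mem hl)) h
  suffices (k : ℝ) = l by exact_mod_cast this
  cases w <;> simp only [angle] at this <;> field_simp at this <;> linarith

end ChebKind

/-! The lower estimate holds because `vpInterp w n m f` is itself a polynomial of degree at most `n
+ m - 1`. For the upper one, the operator reproduces every `P` of degree at most `n - m`
(`vpInterp_eval_eq_self`), so `f - V f = (f - P) - V (f - P)`. It then suffices to bound the
operator in the weighted sup norm, uniformly for `m < n ≤ c m`
(`exists_abs_vpInterp_mul_jacobiWeight_le`).

Put `x = cos t` and `ν = n + shift`. The angles of the nodes are equally spaced with step `π / ν`,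
and multiplication by `root` turns the orthonormal system into plain cosines or sines. In these
terms `V f · u` is a sum over the nodes `s_k` of `f u` times `2 (sin (t/2) / sin (s_k/2)) ^ α (cos
(t/2) / cos (s_k/2)) ^ β D(s_k, t) / ν`, where `α` and `β` are `2γ` and `2δ` minus the exponents of
`root` (`vpInterp_eval_mul_jacobiWeight`). The kernel `D` combines two de la Vallée Poussin kernels,
at `s - t` and `s + t`. Their closed form gives `|D| ≤ K ν / (1 + ν d) ^ 2` with `d = |sin ((t - s)
/ 2)|` (`abs_filteredKernel_mul_le`).

This quadratic decay absorbs ratios with exponents up to 2. A negative exponent, say `α`, makes the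
ratio blow up as `t` tends to 0. It occurs only for systems of sines, whose kernels vanish there and
gain a factor `ν sin (t/2)` (`abs_filteredKernel_mul_le_sin`). The bounds on `γ - δ` keep the weight
at the opposite endpoint under control in that case. What remains are sums of powers with exponent
below -1 over separated points (`exists_sum_ratio_mul_kernel_le`). The half `t ≥ π/2` follows by
reflection. -/

/-! ### Weighted sums of a decaying kernel over separated points. -/

theorem summable_one_add_abs_int_rpow {e : ℝ} (he : 1 < e) :
    Summable fun i : ℤ => (1 + |(i : ℝ)|) ^ (-e) := by
  have h : Summable fun n : ℕ => (1 + (n : ℝ)) ^ (-e) := by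
    have := (summable_nat_add_iff 1).2 (Real.summable_nat_rpow.2 (by linarith : -e < -1))
    simpa [add_comm] using this
  refine Summable.of_nat_of_neg ?_ ?_ <;> simpa using h

/-- Sums of powers over integer points, uniformly in the centre. -/
theorem exists_sum_rpow_le {e c : ℝ} (he : 1 < e) (hc : 0 < c) :
    ∃ C : ℝ, 0 ≤ C ∧ ∀ (s : Finset ℕ) (j : ℤ) (g : ℕ → ℝ),
      (∀ k ∈ s, c * (1 + |(k : ℝ) - j|) ≤ g k) → ∑ k ∈ s, g k ^ (-e) ≤ C := by
  have hs := summable_one_add_abs_int_rpow he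
  have h0 : ∀ i : ℤ, 0 ≤ (1 + |(i : ℝ)|) ^ (-e) := fun i => by positivity
  refine ⟨c ^ (-e) * ∑' i : ℤ, (1 + |(i : ℝ)|) ^ (-e),
    mul_nonneg (by positivity) (tsum_nonneg h0), fun s j g hg => ?_⟩
  let φ : ℕ ↪ ℤ := ⟨fun k => (k : ℤ) - j, fun x y h => by simpa using h⟩
  calc ∑ k ∈ s, g k ^ (-e)
      ≤ ∑ k ∈ s, c ^ (-e) * (1 + |((φ k : ℤ) : ℝ)|) ^ (-e) := by
        refine Finset.sum_le_sum fun k hk => ?_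
        rw [← mul_rpow hc.le (by positivity)]
        refine rpow_le_rpow_of_nonpos (by positivity) ?_ (by linarith)
        have : ((φ k : ℤ) : ℝ) = (k : ℝ) - j := by
          change (((k : ℤ) - j : ℤ) : ℝ) = _
          push_cast; rfl
        rw [this]
        exact hg k hk
    _ = c ^ (-e) * ∑ i ∈ s.map φ, (1 + |(i : ℝ)|) ^ (-e) := by
        rw [Finset.sum_map, Finset.mul_sum]
    _ ≤ _ := by
        gcongr
        exact hs.sum_le_tsum _ fun i _ => h0 i

theorem rpow_le_one_add_sq {x α : ℝ} (hx : 0 ≤ x) (h0 : 0 ≤ α) (h2 : α ≤ 2) :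
    x ^ α ≤ 1 + x ^ 2 := by
  rcases le_total x 1 with h | h
  · nlinarith [rpow_le_one hx h h0, sq_nonneg x]
  · have := rpow_le_rpow_of_exponent_le h h2
    rw [rpow_two] at this
    linarith

/-- Powers with exponent in `[-1, 0)` of a ratio bounded below by one half. -/
theorem div_rpow_le_two {p q β : ℝ} (hp : 1 / 2 ≤ p) (hq : 0 < q) (hq1 : q ≤ 1)
    (hβ : -1 ≤ β) (hβ0 : β < 0) : (p / q) ^ β ≤ 2 := by
  have hp0 : 0 < p := by linarith
  have h : 1 / 2 ≤ p / q := by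
    rw [le_div_iff₀ hq]; nlinarith
  calc (p / q) ^ β ≤ (1 / 2 : ℝ) ^ β := rpow_le_rpow_of_nonpos (by norm_num) h hβ0.le
    _ ≤ (1 / 2 : ℝ) ^ (-1 : ℝ) :=
        rpow_le_rpow_of_exponent_ge (by norm_num) (by norm_num) hβ
    _ = 2 := by rw [rpow_neg_one]; norm_num

theorem div_sq_le_of_le_add {p q d : ℝ} (hp : 0 ≤ p) (hq : 0 < q) (h : p ≤ q + d) :
    (p / q) ^ 2 ≤ 2 * (1 + d ^ 2 / q ^ 2) := by
  have : 2 * (1 + d ^ 2 / q ^ 2) = (2 * q ^ 2 + 2 * d ^ 2) / q ^ 2 := by field_simp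
  rw [this, div_pow]
  gcongr
  nlinarith [sq_nonneg (q - d)]

/-- In the application `a, b` are the sines and `p, q` the cosines of `t/2` and `s/2`, and `d = |sin
((t - s) / 2)|`. A ratio exceeds a constant only by a multiple of `d² / b²` or `d² / q²`, and the
kernel decay turns such a term into `(ν b)⁻²` or `(ν q)⁻²`, each summable over the nodes. -/
theorem ratio_mul_decay_le_of_nonneg {α β a b p q d ν : ℝ} (hα : 0 ≤ α) (hα2 : α ≤ 2)
    (hβ : -1 ≤ β) (hβ2 : β ≤ 2) (ha : 0 < a) (hb : 0 < b) (hp : 1 / 2 ≤ p) (hq : 0 < q)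
    (hbq : b ^ 2 + q ^ 2 = 1) (hd : 0 ≤ d) (hd1 : d ≤ 1) (hν : 0 < ν)
    (hab : a ≤ b + d) (hpq : p ≤ q + d) :
    (a / b) ^ α * (p / q) ^ β * ((1 + ν * d) ^ 2)⁻¹ ≤
      24 * ((1 + ν * d) ^ (-2 : ℝ) + (ν * b) ^ (-2 : ℝ) + (ν * q) ^ (-2 : ℝ)) := by
  have hp0 : 0 < p := by linarith
  have hq1 : q ≤ 1 := by nlinarith
  have h1 : (a / b) ^ α ≤ 3 * (1 + d ^ 2 / b ^ 2) := by
    have := rpow_le_one_add_sq (div_pos ha hb).le hα hα2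
    have := div_sq_le_of_le_add ha.le hb hab
    have : 0 ≤ d ^ 2 / b ^ 2 := by positivity
    linarith
  have h2 : (p / q) ^ β ≤ 4 * (1 + d ^ 2 / q ^ 2) := by
    have h3 : 0 ≤ d ^ 2 / q ^ 2 := by positivity
    rcases lt_or_ge β 0 with hβ0 | hβ0
    · have := div_rpow_le_two hp hq hq1 hβ hβ0
      linarith
    · have := rpow_le_one_add_sq (div_pos hp0 hq).le hβ0 hβ2
      have := div_sq_le_of_le_add hp0.le hq hpq
      linarith
  -- No product term survives: `b² + q² = 1` gives `1 / (b² q²) = 1 / b² + 1 / q²`, and `d ≤ 1`.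
  have h3 : (1 + d ^ 2 / b ^ 2) * (1 + d ^ 2 / q ^ 2) ≤
      1 + 2 * (d ^ 2 / b ^ 2) + 2 * (d ^ 2 / q ^ 2) := by
    have e : d ^ 2 / b ^ 2 * (d ^ 2 / q ^ 2) = d ^ 2 * (d ^ 2 / b ^ 2 + d ^ 2 / q ^ 2) := by
      field_simp
      linear_combination (-d ^ 4) * hbq
    have : 0 ≤ d ^ 2 / b ^ 2 + d ^ 2 / q ^ 2 := by positivity
    have : d ^ 2 ≤ 1 := by nlinarith
    nlinarith
  have h4 : ∀ y : ℝ, 0 < y → d ^ 2 / y ^ 2 * ((1 + ν * d) ^ 2)⁻¹ ≤ ((ν * y) ^ 2)⁻¹ := by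
    intro y hy
    rw [← div_eq_mul_inv, div_div, inv_eq_one_div,
      div_le_div_iff₀ (by positivity) (by positivity)]
    have : 0 ≤ ν * d := by positivity
    have h5 : 0 < y ^ 2 := by positivity
    nlinarith
  have e : ∀ y : ℝ, 0 ≤ y → y ^ (-2 : ℝ) = (y ^ 2)⁻¹ := by
    intro y hy; rw [rpow_neg hy, rpow_two]
  rw [e _ (by positivity), e _ (by positivity), e _ (by positivity)]
  have h5 : (a / b) ^ α * (p / q) ^ β ≤
      12 * (1 + 2 * (d ^ 2 / b ^ 2) + 2 * (d ^ 2 / q ^ 2)) := by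
    have := mul_le_mul h1 h2 (by positivity) (by positivity)
    linarith
  have h6 := mul_le_mul_of_nonneg_right h5 (by positivity : 0 ≤ ((1 + ν * d) ^ 2)⁻¹)
  have h7 : 0 ≤ ((1 + ν * d) ^ 2)⁻¹ := by positivity
  linarith [h4 b hb, h4 q hq]

/-- The factor `min 1 (ν a)` compensates the singularity of `a ^ α` at the cost of `(1 + ν d) ^
(-α)`. The remaining decay exponent `2 + α` still exceeds 1. -/
theorem ratio_mul_decay_le_of_neg {α β a b p q d ν : ℝ} (hα : -1 < α) (hα0 : α < 0)
    (hβ : -1 ≤ β) (hβα : β - α ≤ 2) (ha : 0 < a) (hb : 0 < b) (hp : 1 / 2 ≤ p) (hp1 : p ≤ 1)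
    (hq : 0 < q) (hq1 : q ≤ 1) (hd : 0 ≤ d) (hν : 0 < ν)
    (hba : b ≤ a + d) (hpq : p ≤ q + d) :
    (a / b) ^ α * (p / q) ^ β * (min 1 (ν * a) * ((1 + ν * d) ^ 2)⁻¹) ≤
      16 * ((1 + ν * d) ^ (-(2 + α)) + (ν * q) ^ (-(2 + α))) := by
  have hp0 : 0 < p := by linarith
  have hX : 0 < 1 + ν * d := by positivity
  have h1 : (a / b) ^ α * min 1 (ν * a) ≤ (1 + ν * d) ^ (-α) := by
    have e : (a / b) ^ α = (b / a) ^ (-α) := by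
      rw [rpow_neg (by positivity), ← inv_rpow (by positivity), inv_div]
    rw [e]
    rcases le_total 1 (ν * a) with h | h
    · rw [min_eq_left h, mul_one]
      refine rpow_le_rpow (by positivity) ?_ (by linarith)
      rw [div_le_iff₀ ha]
      nlinarith
    · rw [min_eq_right h]
      have e2 : b / a = (ν * b) / (ν * a) := by field_simp
      rw [e2, div_rpow (by positivity) (by positivity)]
      have h2 : ν * a ≤ (ν * a) ^ (-α) := by
        have := rpow_le_rpow_of_exponent_ge (by positivity) h (by linarith : -α ≤ 1)
        rwa [rpow_one] at this
      have h3 : (ν * b) ^ (-α) ≤ (1 + ν * d) ^ (-α) :=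
        rpow_le_rpow (by positivity) (by nlinarith) (by linarith)
      have h4 : 0 < (ν * a) ^ (-α) := by positivity
      calc (ν * b) ^ (-α) / (ν * a) ^ (-α) * (ν * a)
          ≤ (ν * b) ^ (-α) / (ν * a) ^ (-α) * (ν * a) ^ (-α) := by gcongr
        _ = (ν * b) ^ (-α) := by field_simp
        _ ≤ _ := h3
  have h2 : (1 + ν * d) ^ (-α) * ((1 + ν * d) ^ 2)⁻¹ = (1 + ν * d) ^ (-(2 + α)) := by
    rw [← rpow_two, ← rpow_neg hX.le, ← rpow_add hX]
    congr 1; ring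
  have h3 : (p / q) ^ β * (1 + ν * d) ^ (-(2 + α)) ≤
      16 * ((1 + ν * d) ^ (-(2 + α)) + (ν * q) ^ (-(2 + α))) := by
    have hY : 0 < (1 + ν * d) ^ (-(2 + α)) := by positivity
    have hZ : 0 < (ν * q) ^ (-(2 + α)) := by positivity
    suffices h : (p / q) ^ β ≤ 16 ∨
        (p / q) ^ β * (1 + ν * d) ^ (-(2 + α)) ≤ 16 * (ν * q) ^ (-(2 + α)) by
      rcases h with h | h <;> nlinarith
    rcases lt_or_ge β 0 with hβ0 | hβ0
    · left; linarith [div_rpow_le_two hp hq hq1 hβ hβ0]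
    have hle : (p / q) ^ β ≤ q ^ (-β) := by
      rw [div_rpow hp0.le hq.le, rpow_neg hq.le, div_eq_mul_inv]
      have := rpow_le_one hp0.le hp1 hβ0
      have : 0 ≤ (q ^ β)⁻¹ := by positivity
      nlinarith
    have h16 : ∀ e : ℝ, e ≤ 2 → (1 / 4 : ℝ) ^ (-e) ≤ 16 := by
      intro e he
      calc (1 / 4 : ℝ) ^ (-e) ≤ (1 / 4 : ℝ) ^ (-2 : ℝ) :=
            rpow_le_rpow_of_exponent_ge (by norm_num) (by norm_num) (by linarith)
        _ = 16 := by rw [rpow_neg (by norm_num), rpow_two]; norm_num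
    -- For `q ≤ 1/4` the bound `p ≥ 1/2` forces `d ≥ 1/4`, so the decay is a full power of `ν`. Then
    -- `β ≤ 2 + α` lets `q ^ (-(2 + α))` absorb the cosine ratio.
    rcases le_total (1 / 4) q with h4 | h4
    · left
      calc _ ≤ q ^ (-β) := hle
        _ ≤ (1 / 4 : ℝ) ^ (-β) := rpow_le_rpow_of_nonpos (by norm_num) h4 (by linarith)
        _ ≤ 16 := h16 β (by linarith)
    · right
      have h5 : (1 + ν * d) ^ (-(2 + α)) ≤ (ν * (1 / 4)) ^ (-(2 + α)) :=
        rpow_le_rpow_of_nonpos (by positivity) (by nlinarith) (by linarith)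
      have h6 : q ^ (-β) ≤ q ^ (-(2 + α)) :=
        rpow_le_rpow_of_exponent_ge hq hq1 (by linarith)
      calc (p / q) ^ β * (1 + ν * d) ^ (-(2 + α))
          ≤ q ^ (-(2 + α)) * (ν * (1 / 4)) ^ (-(2 + α)) :=
            mul_le_mul (hle.trans h6) h5 hY.le (by positivity)
        _ = (1 / 4 : ℝ) ^ (-(2 + α)) * (ν * q) ^ (-(2 + α)) := by
            rw [mul_rpow hν.le (by norm_num), mul_rpow hν.le hq.le]; ring
        _ ≤ _ := by gcongr; exact h16 _ (by linarith)
  calc _ = ((a / b) ^ α * min 1 (ν * a)) * ((p / q) ^ β * ((1 + ν * d) ^ 2)⁻¹) := by ring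
    _ ≤ (1 + ν * d) ^ (-α) * ((p / q) ^ β * ((1 + ν * d) ^ 2)⁻¹) := by gcongr
    _ = (p / q) ^ β * ((1 + ν * d) ^ (-α) * ((1 + ν * d) ^ 2)⁻¹) := by ring
    _ ≤ _ := by rw [h2]; exact h3

theorem sin_half_le_add (s t : ℝ) (h : 0 ≤ sin (s / 2)) :
    sin (t / 2) ≤ sin (s / 2) + |sin ((t - s) / 2)| := by
  have e : sin (t / 2) = sin (s / 2) * cos ((t - s) / 2) + cos (s / 2) * sin ((t - s) / 2) := by
    rw [← sin_add]; ring_nf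
  rw [e]
  have h1 : cos (s / 2) * sin ((t - s) / 2) ≤ |sin ((t - s) / 2)| := by
    refine (le_abs_self _).trans ?_
    rw [abs_mul]
    exact mul_le_of_le_one_left (abs_nonneg _) (abs_cos_le_one _)
  nlinarith [cos_le_one ((t - s) / 2)]

theorem cos_half_le_add (s t : ℝ) (h : 0 ≤ cos (s / 2)) :
    cos (t / 2) ≤ cos (s / 2) + |sin ((t - s) / 2)| := by
  have := sin_half_le_add (π - s) (π - t) (by rwa [sub_div, sin_pi_div_two_sub])
  rwa [sub_div, sin_pi_div_two_sub, sub_div π s, sin_pi_div_two_sub,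
    show (π - t - (π - s)) / 2 = -((t - s) / 2) by ring, sin_neg, abs_neg] at this

/-- Weighted sums of a localized kernel over separated nodes, evaluated in the left half. -/
theorem exists_sum_ratio_mul_kernel_le {α β c K : ℝ} (hα : -1 < α) (hα2 : α ≤ 2)
    (hβ : -1 ≤ β) (hβ2 : β ≤ 2) (hαβ : α < 0 → β - α ≤ 2) (hc : 0 < c) (hK : 0 ≤ K) :
    ∃ C : ℝ, ∀ (S : Finset ℕ) (ν t : ℝ) (s D : ℕ → ℝ) (j₀ j₁ j₂ : ℤ), 0 < ν →
      t ∈ Set.Ioc 0 (π / 2) → (∀ k ∈ S, s k ∈ Set.Ioo 0 π) →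
      (∀ k ∈ S, c * (1 + |(k : ℝ) - j₀|) ≤ 1 + ν * |sin ((t - s k) / 2)|) →
      (∀ k ∈ S, c * (1 + |(k : ℝ) - j₁|) ≤ ν * sin (s k / 2)) →
      (∀ k ∈ S, c * (1 + |(k : ℝ) - j₂|) ≤ ν * cos (s k / 2)) →
      (∀ k ∈ S, |D k| * (1 + ν * |sin ((t - s k) / 2)|) ^ 2 ≤ K * ν) →
      (α < 0 → ∀ k ∈ S, |D k| * (1 + ν * |sin ((t - s k) / 2)|) ^ 2 ≤
        K * ν * (ν * sin (t / 2))) →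
      ∑ k ∈ S, (sin (t / 2) / sin (s k / 2)) ^ α * (cos (t / 2) / cos (s k / 2)) ^ β *
        (|D k| / ν) ≤ C := by
  -- One exponent for both signs of `α`: decay 2 if `α ≥ 0`, and `2 + α` if `α < 0`. The three sums
  -- are centred at the indices of `t` and of the two endpoints.
  have he : 1 < min 2 (2 + α) := lt_min (by norm_num) (by linarith)
  obtain ⟨C, hC0, hC⟩ := exists_sum_rpow_le he hc
  refine ⟨24 * K * (C + C + C), fun S ν t s D j₀ j₁ j₂ hν ht hs h0 h1 h2 hD hD' => ?_⟩
  have hpi := pi_pos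
  have hat : 0 < sin (t / 2) := sin_pos_of_pos_of_lt_pi (by linarith [ht.1]) (by linarith [ht.2])
  have hpt : 1 / 2 ≤ cos (t / 2) := by
    rw [← cos_pi_div_three]
    exact cos_le_cos_of_nonneg_of_le_pi (by linarith [ht.1]) (by linarith) (by linarith [ht.2])
  have key : ∀ k ∈ S, (sin (t / 2) / sin (s k / 2)) ^ α * (cos (t / 2) / cos (s k / 2)) ^ β *
        (|D k| / ν) ≤ 24 * K * ((1 + ν * |sin ((t - s k) / 2)|) ^ (-min 2 (2 + α)) +
          (ν * sin (s k / 2)) ^ (-min 2 (2 + α)) + (ν * cos (s k / 2)) ^ (-min 2 (2 + α))) := by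
    intro k hk
    obtain ⟨hs0, hs1⟩ := hs k hk
    have hb : 0 < sin (s k / 2) := sin_pos_of_pos_of_lt_pi (by linarith) (by linarith)
    have hq : 0 < cos (s k / 2) := cos_pos_of_mem_Ioo ⟨by linarith, by linarith⟩
    have hab := sin_half_le_add (s k) t hb.le
    have hba := sin_half_le_add t (s k) hat.le
    have hpq := cos_half_le_add (s k) t hq.le
    rw [show (s k - t) / 2 = -((t - s k) / 2) by ring, sin_neg, abs_neg] at hba
    have hDk := hD k hk
    have hd := abs_nonneg (sin ((t - s k) / 2))
    have hd1 := abs_sin_le_one ((t - s k) / 2)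
    set d := |sin ((t - s k) / 2)|
    have hX : 0 < (1 + ν * d) ^ 2 := by positivity
    have hR : 0 < (sin (t / 2) / sin (s k / 2)) ^ α * (cos (t / 2) / cos (s k / 2)) ^ β := by
      have : 0 < cos (t / 2) := by linarith
      positivity
    rcases lt_or_ge α 0 with hα0 | hα0
    · have hm : min 2 (2 + α) = 2 + α := min_eq_right (by linarith)
      rw [hm]
      have hDk' := hD' hα0 k hk
      have hDle : |D k| / ν ≤ K * (min 1 (ν * sin (t / 2)) * ((1 + ν * d) ^ 2)⁻¹) := by
        rw [div_le_iff₀ hν, ← mul_assoc, mul_right_comm, le_mul_inv_iff₀ hX]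
        rcases min_cases 1 (ν * sin (t / 2)) with ⟨h, -⟩ | ⟨h, -⟩ <;> rw [h] <;> nlinarith
      have := ratio_mul_decay_le_of_neg hα hα0 hβ (hαβ hα0) hat hb hpt (cos_le_one _) hq
        (cos_le_one _) hd hν hba hpq
      have hb' : 0 ≤ (ν * sin (s k / 2)) ^ (-(2 + α)) := by positivity
      have hq' : 0 ≤ (ν * cos (s k / 2)) ^ (-(2 + α)) := by positivity
      have hd' : 0 ≤ (1 + ν * d) ^ (-(2 + α)) := by positivity
      calc _ ≤ (sin (t / 2) / sin (s k / 2)) ^ α * (cos (t / 2) / cos (s k / 2)) ^ β *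
            (K * (min 1 (ν * sin (t / 2)) * ((1 + ν * d) ^ 2)⁻¹)) := by gcongr
        _ = K * ((sin (t / 2) / sin (s k / 2)) ^ α * (cos (t / 2) / cos (s k / 2)) ^ β *
            (min 1 (ν * sin (t / 2)) * ((1 + ν * d) ^ 2)⁻¹)) := by ring
        _ ≤ K * (16 * ((1 + ν * d) ^ (-(2 + α)) + (ν * cos (s k / 2)) ^ (-(2 + α)))) := by
            gcongr
        _ ≤ K * (24 * ((1 + ν * d) ^ (-(2 + α)) + (ν * sin (s k / 2)) ^ (-(2 + α)) +
            (ν * cos (s k / 2)) ^ (-(2 + α)))) := by gcongr K * ?_; linarith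
        _ = _ := by ring
    · have hm : min 2 (2 + α) = 2 := min_eq_left (by linarith)
      rw [hm]
      have hDle : |D k| / ν ≤ K * ((1 + ν * d) ^ 2)⁻¹ := by
        rw [div_le_iff₀ hν, mul_right_comm, le_mul_inv_iff₀ hX]
        exact hDk
      have := ratio_mul_decay_le_of_nonneg hα0 hα2 hβ hβ2 hat hb hpt hq
        (sin_sq_add_cos_sq _) hd hd1 hν hab hpq
      calc _ ≤ (sin (t / 2) / sin (s k / 2)) ^ α * (cos (t / 2) / cos (s k / 2)) ^ β *
            (K * ((1 + ν * d) ^ 2)⁻¹) := by gcongr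
        _ = K * ((sin (t / 2) / sin (s k / 2)) ^ α * (cos (t / 2) / cos (s k / 2)) ^ β *
            ((1 + ν * d) ^ 2)⁻¹) := by ring
        _ ≤ _ := by
            rw [mul_comm 24 K, mul_assoc K 24]
            exact mul_le_mul_of_nonneg_left this hK
  refine (Finset.sum_le_sum key).trans ?_
  rw [← Finset.mul_sum, Finset.sum_add_distrib, Finset.sum_add_distrib]
  have := hC S j₀ _ h0
  have := hC S j₁ _ h1
  have := hC S j₂ _ h2
  gcongr

/-! ### Trigonometric form of the orthonormal systems. -/

namespace ChebKind

/-- The frequency shift of the trigonometric form of the orthonormal system. -/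
noncomputable def shift : ChebKind → ℝ
  | w1 => 0
  | w2 => 1
  | w3 => 1 / 2
  | w4 => 1 / 2

/-- The index offset of the angles of the nodes. -/
noncomputable def offset : ChebKind → ℝ
  | w1 => 1 / 2
  | w2 => 0
  | w3 => 1 / 2
  | w4 => 0

/-- The square root of the factor of the weight, as a function of the angle. -/
noncomputable def root : ChebKind → ℝ → ℝ
  | w1, _ => 1
  | w2, t => sin t
  | w3, t => √2 * cos (t / 2)
  | w4, t => √2 * sin (t / 2)

/-- The trigonometric form of the orthonormal system, up to normalization. -/
noncomputable def trig : ChebKind → ℕ → ℝ → ℝ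
  | w1, j, t => if j = 0 then 1 / √2 else cos (j * t)
  | w2, j, t => sin ((j + 1) * t)
  | w3, j, t => cos ((j + 1 / 2) * t)
  | w4, j, t => sin ((j + 1 / 2) * t)

/-- The sign of the reflected part of the kernel. -/
noncomputable def parity : ChebKind → ℝ
  | w1 => 1
  | w2 => -1
  | w3 => 1
  | w4 => -1

/-- Puts the four families in a common form: equally spaced angles with step `π / (n + shift)`. -/
theorem angle_eq (w : ChebKind) (n k : ℕ) :
    w.angle n k = (k - w.offset) * π / (n + w.shift) := by
  rcases Nat.eq_zero_or_pos n with rfl | hn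
  · cases w <;> simp [angle, offset, shift]
    all_goals ring
  · have : (0 : ℝ) < n := by exact_mod_cast hn
    cases w <;> simp only [angle, offset, shift] <;> field_simp <;> ring

theorem root_pos (w : ChebKind) {t : ℝ} (ht : t ∈ Set.Ioo 0 π) : 0 < w.root t := by
  have hpi := pi_pos
  obtain ⟨h0, h1⟩ := ht
  have : 0 < sin (t / 2) := sin_pos_of_pos_of_lt_pi (by linarith) (by linarith)
  have : 0 < cos (t / 2) := cos_pos_of_mem_Ioo ⟨by linarith, by linarith⟩
  have := sin_pos_of_pos_of_lt_pi h0 h1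
  cases w <;> simp only [root] <;> positivity

theorem abs_trig_le_one (w : ChebKind) (j : ℕ) (t : ℝ) : |w.trig j t| ≤ 1 := by
  cases w <;> simp only [trig]
  · split_ifs
    · rw [abs_of_pos (by positivity), div_le_one (by positivity)]
      exact one_le_sqrt.2 (by norm_num)
    · exact abs_cos_le_one _
  · exact abs_sin_le_one _
  · exact abs_cos_le_one _
  · exact abs_sin_le_one _

/-- Multiplying by `root` clears the denominators of the Chebyshev quotients. The value `1 / √2` of
`trig` for `w1` and `j = 0` absorbs the different normalization of the constant polynomial. -/
theorem orthoPoly_eval_cos_mul_root (w : ChebKind) (j : ℕ) {t : ℝ} (ht : t ∈ Set.Ioo 0 π) :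
    (w.orthoPoly j).eval (cos t) * w.root t = √(2 / π) * w.trig j t := by
  have hpi := pi_pos
  obtain ⟨h0, h1⟩ := ht
  have hs : sin (t / 2) ≠ 0 := (sin_pos_of_pos_of_lt_pi (by linarith) (by linarith)).ne'
  have hc : cos (t / 2) ≠ 0 := (cos_pos_of_mem_Ioo ⟨by linarith, by linarith⟩).ne'
  have hq : √(2 / π) = √2 / √π := sqrt_div (by norm_num) _
  cases w <;> simp only [orthoPoly, root, trig, eval_mul, eval_C, hq]
  · rw [Chebyshev.T_real_cos]
    split_ifs with h
    · subst h
      have : √2 ≠ 0 := by positivity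
      simp
      field_simp
    · push_cast; ring
  · have := Chebyshev.U_real_cos t j
    push_cast at this
    rw [mul_assoc, this]
  · have := eval_third_mul j t hs
    rw [show (j + 1 / 2 : ℝ) * t = (2 * ((j : ℤ) : ℝ) + 1) * t / 2 by push_cast; ring, ← this]
    ring
  · have := eval_fourth_mul j t hc
    rw [show (j + 1 / 2 : ℝ) * t = (2 * ((j : ℤ) : ℝ) + 1) * t / 2 by push_cast; ring, ← this]
    ring

end ChebKind

/-! ### Discrete orthogonality, Christoffel numbers and Gauss quadrature. -/

theorem two_mul_sin_half_mul_sum_cos (n : ℕ) (ε x : ℝ) :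
    2 * sin (x / 2) * ∑ k ∈ Finset.Icc 1 n, cos ((k - ε) * x) =
      sin ((n + 1 / 2 - ε) * x) - sin ((1 / 2 - ε) * x) := by
  induction n with
  | zero => simp
  | succ n ih =>
    rw [Finset.sum_Icc_succ_top (by omega), mul_add, ih]
    have := sin_sub_sin ((n + 1 + 1 / 2 - ε) * x) ((n + 1 / 2 - ε) * x)
    rw [show ((n + 1 + 1 / 2 - ε) * x - (n + 1 / 2 - ε) * x) / 2 = x / 2 by ring,
      show ((n + 1 + 1 / 2 - ε) * x + (n + 1 / 2 - ε) * x) / 2 = (n + 1 - ε) * x by ring] at this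
    push_cast
    linarith

namespace ChebKind

theorem shift_add_pos (w : ChebKind) {n : ℕ} (hn : 0 < n) : 0 < n + w.shift := by
  have : (0 : ℝ) < n := by exact_mod_cast hn
  cases w <;> simp only [shift] <;> linarith

/-- Sums of cosines over the nodes, for frequencies below the aliasing bound. -/
theorem sum_cos_angle (w : ChebKind) {n : ℕ} (hn : 0 < n) {q : ℤ} (hq : q ≠ 0)
    (hq' : |(q : ℝ)| < 2 * (n + w.shift)) :
    ∑ k ∈ Finset.Icc 1 n, cos (q * w.angle n k) =
      match w with
      | w1 => 0
      | w2 => -(1 + cos (q * π)) / 2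
      | w3 => -cos (q * π) / 2
      | w4 => -1 / 2 := by
  have hpi := pi_pos
  have hν := w.shift_add_pos hn
  set ν := n + w.shift with hνdef
  -- The aliasing bound places `q π / (2 ν)` in `(-π, π)`, away from 0, so this sine can be
  -- cancelled.
  have hne : sin (q * π / ν / 2) ≠ 0 := by
    have h1 := abs_lt.1 hq'
    have hq0 : (q : ℝ) ≠ 0 := by exact_mod_cast hq
    rw [Ne, sin_eq_zero_iff_of_lt_of_lt]
    · positivity
    · rw [div_div, lt_div_iff₀ (by positivity)]; nlinarith
    · rw [div_div, div_lt_iff₀ (by positivity)]; nlinarith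
  have e : ∀ k : ℕ, q * w.angle n k = (k - w.offset) * (q * π / ν) := by
    intro k; rw [angle_eq]; ring
  simp only [e]
  have h := two_mul_sin_half_mul_sum_cos n w.offset (q * π / ν)
  have hsin : sin (q * π) = 0 := sin_int_mul_pi q
  set S := ∑ k ∈ Finset.Icc 1 n, cos ((k - w.offset) * (q * π / ν))
  -- The upper frequency factor `n + 1/2 - offset` equals `ν` for `w1` and `w4`, and `ν - 1/2` for
  -- `w2` and `w3`.
  have hfull : ∀ y : ℝ, y = ν → y * (q * π / ν) = q * π := by
    rintro y rfl; field_simp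
  have hhalf : ∀ y : ℝ, y = ν - 1 / 2 → sin (y * (q * π / ν)) =
      -cos (q * π) * sin (q * π / ν / 2) := by
    rintro y rfl
    rw [show (ν - 1 / 2) * (q * π / ν) = q * π - q * π / ν / 2 by
      field_simp, sin_sub, hsin]
    ring
  refine mul_left_cancel₀ (mul_ne_zero two_ne_zero hne) (h.trans ?_)
  cases w
  · simp only [offset, shift] at hνdef ⊢
    rw [hfull _ (by rw [hνdef]; ring), hsin]; simp
  · simp only [offset, shift] at hνdef ⊢
    rw [hhalf _ (by rw [hνdef]; ring),
      show (1 / 2 - 0) * (q * π / ν) = q * π / ν / 2 by ring]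
    ring
  · simp only [offset, shift] at hνdef ⊢
    rw [hhalf _ (by rw [hνdef])]
    simp only [sub_self, zero_mul, sin_zero]
    ring
  · simp only [offset, shift] at hνdef ⊢
    rw [hfull _ (by rw [hνdef]; ring), hsin,
      show (1 / 2 - 0) * (q * π / ν) = q * π / ν / 2 by ring]
    ring

theorem two_mul_cos_mul_cos_eq (x y : ℝ) : 2 * (cos x * cos y) = cos (x - y) + cos (x + y) := by
  rw [cos_sub, cos_add]; ring

theorem two_mul_sin_mul_sin_eq (x y : ℝ) : 2 * (sin x * sin y) = cos (x - y) - cos (x + y) := by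
  rw [cos_sub, cos_add]; ring

/-- Discrete orthogonality of the trigonometric systems at the nodes. -/
theorem sum_trig_mul_trig (w : ChebKind) {n i j : ℕ} (hn : 0 < n) (hij : i + j < 2 * n) :
    ∑ k ∈ Finset.Icc 1 n, w.trig i (w.angle n k) * w.trig j (w.angle n k) =
      if i = j then (n + w.shift) / 2 else 0 := by
  have hn' : (0 : ℝ) < n := by exact_mod_cast hn
  have hij' : (i : ℝ) + j + 1 ≤ 2 * n := by exact_mod_cast hij
  have hi0 : (0 : ℝ) ≤ i := by positivity
  have hj0 : (0 : ℝ) ≤ j := by positivity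
  have hd : i ≠ j → ((i - j : ℤ)) ≠ 0 := by omega
  have hdlt : |((i - j : ℤ) : ℝ)| < 2 * (n + w.shift) := by
    have : 0 ≤ w.shift := by cases w <;> simp only [shift] <;> norm_num
    push_cast
    rw [abs_lt]; constructor <;> linarith
  suffices h : 2 * ∑ k ∈ Finset.Icc 1 n, w.trig i (w.angle n k) * w.trig j (w.angle n k) =
      if i = j then n + w.shift else 0 by
    split_ifs at h ⊢ <;> linarith
  rw [Finset.mul_sum]
  have hone : ∀ a : ℕ → ℝ, ∑ k ∈ Finset.Icc 1 n, cos ((0 : ℝ) * a k) = n := by simp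
  cases w
  · have hs : ∀ p : ℤ, p ≠ 0 → |(p : ℝ)| < 2 * n →
        ∑ k ∈ Finset.Icc 1 n, cos (p * w1.angle n k) = 0 := fun p hp hp' =>
      w1.sum_cos_angle hn hp (by simpa [shift] using hp')
    have h2 : √2 * √2 = 2 := mul_self_sqrt (by norm_num)
    have h20 : √2 ≠ 0 := by positivity
    have hj : ∀ l : ℕ, l ≠ 0 → l < 2 * n →
        ∑ k ∈ Finset.Icc 1 n, cos (l * w1.angle n k) = 0 := fun l hl hl' => by
      have := hs l (by exact_mod_cast hl) (by
        rw [abs_of_nonneg (by positivity)]; exact_mod_cast hl')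
      exact_mod_cast this
    simp only [trig, shift, add_zero]
    by_cases hi : i = 0
    · by_cases hj1 : j = 0
      · simp only [hi, hj1, if_true, div_mul_div_comm, h2]
        simp
      · simp only [hi, hj1, if_true, if_false, Ne.symm hj1, ← mul_assoc]
        rw [← Finset.mul_sum, hj j hj1 (by omega), mul_zero]
    · by_cases hj1 : j = 0
      · simp only [hi, hj1, if_true, if_false]
        simp_rw [mul_comm (cos _), ← mul_assoc]
        rw [← Finset.mul_sum, hj i hi (by omega), mul_zero]
      · simp only [hi, hj1, if_false, two_mul_cos_mul_cos_eq, ← sub_mul, ← add_mul]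
        rw [Finset.sum_add_distrib]
        have h3 := hj (i + j) (by omega) hij
        push_cast at h3
        rw [h3, add_zero]
        split_ifs with h
        · subst h; rw [sub_self]; exact hone _
        · have := hs (i - j) (hd h) (by simpa [shift] using hdlt)
          exact_mod_cast this
  -- From here on the two cosine sums need not vanish separately. For `i ≠ j` they cancel: the
  -- frequencies `i - j` and `i + j + 2` have equal parity, while for `w3` below `i - j` and `i + j
  -- + 1` have opposite parity and the sums are added.
  · simp only [trig, shift, two_mul_sin_mul_sin_eq, ← sub_mul, ← add_mul]
    rw [Finset.sum_sub_distrib]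
    have h3 := w2.sum_cos_angle hn (q := i + j + 2) (by omega) (by
      push_cast; simp only [shift]; rw [abs_of_nonneg (by positivity)]; linarith)
    simp only at h3
    push_cast at h3
    rw [show (i + 1 + (j + 1) : ℝ) = i + j + 2 by ring, h3, add_sub_add_right_eq_sub]
    split_ifs with h
    · subst h
      rw [sub_self, hone, show (i + i + 2 : ℝ) * π = ((i + 1 : ℕ) : ℝ) * (2 * π) by
        push_cast; ring, cos_nat_mul_two_pi]
      ring
    · have := w2.sum_cos_angle hn (hd h) hdlt
      simp only at this
      push_cast at this
      rw [this, show (i + j + 2 : ℝ) * π = (i - j) * π + ((j + 1 : ℕ) : ℝ) * (2 * π) by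
        push_cast; ring, cos_add_nat_mul_two_pi]
      ring
  · simp only [trig, shift, two_mul_cos_mul_cos_eq, ← sub_mul, ← add_mul]
    rw [Finset.sum_add_distrib]
    have h3 := w3.sum_cos_angle hn (q := i + j + 1) (by omega) (by
      push_cast; simp only [shift]; rw [abs_of_nonneg (by positivity)]; linarith)
    simp only at h3
    push_cast at h3
    rw [show (i + 1 / 2 + (j + 1 / 2) : ℝ) = i + j + 1 by ring, h3, add_sub_add_right_eq_sub]
    have e : cos ((i + j + 1 : ℝ) * π) = -cos ((i - j : ℝ) * π) := by
      rw [show (i + j + 1 : ℝ) * π = (i - j) * π + (j : ℝ) * (2 * π) + π by ring, cos_add_pi,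
        cos_add_nat_mul_two_pi]
    rw [e]
    split_ifs with h
    · subst h
      rw [sub_self, hone, zero_mul, cos_zero]
      ring
    · have := w3.sum_cos_angle hn (hd h) hdlt
      simp only at this
      push_cast at this
      rw [this]
      ring
  · simp only [trig, shift, two_mul_sin_mul_sin_eq, ← sub_mul, ← add_mul]
    rw [Finset.sum_sub_distrib]
    have h3 := w4.sum_cos_angle hn (q := i + j + 1) (by omega) (by
      push_cast; simp only [shift]; rw [abs_of_nonneg (by positivity)]; linarith)
    simp only at h3
    push_cast at h3
    rw [show (i + 1 / 2 + (j + 1 / 2) : ℝ) = i + j + 1 by ring, h3, add_sub_add_right_eq_sub]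
    split_ifs with h
    · subst h
      rw [sub_self, hone]
      ring
    · have := w4.sum_cos_angle hn (hd h) hdlt
      simp only at this
      push_cast at this
      rw [this]
      ring

/-- The dual orthogonality relation on the diagonal. -/
theorem sum_trig_sq (w : ChebKind) {n k : ℕ} (hk : k ∈ Finset.Icc 1 n) :
    ∑ j ∈ Finset.range n, w.trig j (w.angle n k) ^ 2 = (n + w.shift) / 2 := by
  obtain ⟨hk1, hkn⟩ := Finset.mem_Icc.1 hk
  have hn : 0 < n := by omega
  have hν := w.shift_add_pos hn
  set ν := n + w.shift with hνdef
  let M : Matrix (Fin n) (Fin n) ℝ :=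
    Matrix.of fun i l => w.trig i (w.angle n (l + 1))
  have hM : M * ((2 / ν) • M.transpose) = 1 := by
    ext i j
    rw [Matrix.mul_smul, Matrix.smul_apply, Matrix.mul_apply, Matrix.one_apply]
    have h := w.sum_trig_mul_trig hn (i := i) (j := j) (by omega)
    have e : ∑ l : Fin n, M i l * M.transpose l j =
        ∑ k ∈ Finset.Icc 1 n, w.trig i (w.angle n k) * w.trig j (w.angle n k) := by
      simp only [M, Matrix.transpose_apply, Matrix.of_apply]
      rw [Fin.sum_univ_eq_sum_range
        (fun l => w.trig i (w.angle n (l + 1)) * w.trig j (w.angle n (l + 1))),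
        Finset.range_eq_Ico, Finset.sum_Ico_add' (fun k => w.trig i (w.angle n k) *
          w.trig j (w.angle n k)) 0 n 1]
      rfl
    rw [e, h, ← hνdef]
    by_cases hij : i = j
    · simp only [hij, if_true, smul_eq_mul]; field_simp
    · have : (i : ℕ) ≠ j := fun h => hij (Fin.ext h)
      simp [hij, this]
  -- A one-sided inverse of a square matrix is two-sided; this turns orthogonality of rows into
  -- orthogonality of columns.
  have hM' := mul_eq_one_comm.1 hM
  have h := congrFun (congrFun hM' ⟨k - 1, by omega⟩) ⟨k - 1, by omega⟩
  rw [Matrix.smul_mul, Matrix.smul_apply, Matrix.mul_apply, Matrix.one_apply_eq] at h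
  have e : ∑ j : Fin n, M.transpose ⟨k - 1, by omega⟩ j * M j ⟨k - 1, by omega⟩ =
      ∑ j ∈ Finset.range n, w.trig j (w.angle n k) ^ 2 := by
    rw [← Fin.sum_univ_eq_sum_range (fun j => w.trig j (w.angle n k) ^ 2)]
    refine Finset.sum_congr rfl fun j _ => ?_
    simp only [M, Matrix.transpose_apply, Matrix.of_apply]
    rw [show k - 1 + 1 = k by omega, sq]
  rw [e, smul_eq_mul] at h
  field_simp at h ⊢
  linarith

/-- The term `j = n` vanishes at the nodes, so only the `n` terms of the dual orthogonality relation
remain. -/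
theorem christoffel_eq (w : ChebKind) {n k : ℕ} (hk : k ∈ Finset.Icc 1 n) :
    w.christoffel n k = π / (n + w.shift) * w.root (w.angle n k) ^ 2 := by
  have hpi := pi_pos
  obtain ⟨hk1, hkn⟩ := Finset.mem_Icc.1 hk
  have hν := w.shift_add_pos (by omega : 0 < n)
  have hr := w.root_pos (w.angle_mem hk)
  have h2 : √(2 / π) ^ 2 = 2 / π := sq_sqrt (by positivity)
  rw [christoffel, Finset.sum_range_succ, w.orthoPoly_eval_node hk]
  have e : ∀ j, (w.orthoPoly j).eval (w.node n k) ^ 2 =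
      2 / π / w.root (w.angle n k) ^ 2 * w.trig j (w.angle n k) ^ 2 := by
    intro j
    rw [node, eq_div_of_mul_eq hr.ne' (w.orthoPoly_eval_cos_mul_root j (w.angle_mem hk)),
      div_pow, mul_pow, h2]
    ring
  simp only [e]
  rw [← Finset.mul_sum, w.sum_trig_sq hk]
  field_simp
  simp

/-- Gauss quadrature on products of total degree below `2n`: the factor `root²` of the Christoffel
number turns both polynomials into their trigonometric forms. -/
theorem sum_christoffel_mul (w : ChebKind) {n i j : ℕ} (hn : 0 < n) (hij : i + j < 2 * n) :
    ∑ k ∈ Finset.Icc 1 n, w.christoffel n k * ((w.orthoPoly i).eval (w.node n k) *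
      (w.orthoPoly j).eval (w.node n k)) = if i = j then 1 else 0 := by
  have hpi := pi_pos
  have hν := w.shift_add_pos hn
  have h2 : √(2 / π) * √(2 / π) = 2 / π := mul_self_sqrt (by positivity)
  have e : ∀ k ∈ Finset.Icc 1 n, w.christoffel n k * ((w.orthoPoly i).eval (w.node n k) *
      (w.orthoPoly j).eval (w.node n k)) =
      2 / (n + w.shift) * (w.trig i (w.angle n k) * w.trig j (w.angle n k)) := by
    intro k hk
    have h3 := w.orthoPoly_eval_cos_mul_root i (w.angle_mem hk)
    have h4 := w.orthoPoly_eval_cos_mul_root j (w.angle_mem hk)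
    rw [w.christoffel_eq hk, node]
    calc _ = π / (n + w.shift) * (((w.orthoPoly i).eval (cos (w.angle n k)) *
          w.root (w.angle n k)) * ((w.orthoPoly j).eval (cos (w.angle n k)) *
          w.root (w.angle n k))) := by ring
      _ = π / (n + w.shift) * (√(2 / π) * √(2 / π)) *
          (w.trig i (w.angle n k) * w.trig j (w.angle n k)) := by rw [h3, h4]; ring
      _ = _ := by rw [h2]; field_simp
  rw [Finset.sum_congr rfl e, ← Finset.mul_sum, w.sum_trig_mul_trig hn hij]
  split_ifs
  · field_simp
  · simp

end ChebKind

/-! ### Reproduction of polynomials and degree of the interpolant. -/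

/-- Polynomials of low degree lie in every subspace containing a graded system. -/
theorem mem_of_natDegree_le {S : Submodule ℝ ℝ[X]} {p : ℕ → ℝ[X]} {N : ℕ}
    (hdeg : ∀ i, (p i).natDegree = i) (hlead : ∀ i, 0 < (p i).leadingCoeff)
    (hS : ∀ i ≤ N, p i ∈ S) {P : ℝ[X]} (hP : P.natDegree ≤ N) : P ∈ S := by
  have key : ∀ M : ℕ, M ≤ N + 1 → ∀ Q : ℝ[X], Q.degree < M → Q ∈ S := by
    intro M
    induction M with
    | zero =>
      intro _ Q hQ
      have : Q = 0 := by simpa using hQ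
      rw [this]; exact S.zero_mem
    | succ M ih =>
      intro hM Q hQ
      set a := Q.coeff M / (p M).leadingCoeff with ha
      have h1 : Q - a • p M ∈ S := by
        refine ih (by omega) _ ((degree_lt_iff_coeff_zero _ _).2 fun k hk => ?_)
        rw [coeff_sub, coeff_smul, smul_eq_mul]
        rcases hk.eq_or_lt with rfl | hk
        · have : (p M).coeff M = (p M).leadingCoeff := by rw [leadingCoeff, hdeg]
          rw [this, ha, div_mul_cancel₀ _ (hlead M).ne', sub_self]
        · rw [(degree_lt_iff_coeff_zero _ _).1 hQ k (by omega),
            coeff_eq_zero_of_natDegree_lt (by rw [hdeg]; exact hk)]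
          simp
      have h2 := S.add_mem h1 (S.smul_mem a (hS M (by omega)))
      rwa [sub_add_cancel] at h2
  refine key (N + 1) le_rfl P (lt_of_le_of_lt degree_le_natDegree ?_)
  exact_mod_cast Nat.lt_succ_of_le hP

theorem vpInterp_add (w : ChebKind) (n m : ℕ) (f g : ℝ → ℝ) :
    vpInterp w n m (fun x => f x + g x) = vpInterp w n m f + vpInterp w n m g := by
  simp [vpInterp, add_mul, Finset.sum_add_distrib]

theorem vpInterp_smul (w : ChebKind) (n m : ℕ) (a : ℝ) (f : ℝ → ℝ) :
    vpInterp w n m (fun x => a * f x) = a • vpInterp w n m f := by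
  simp [vpInterp, Finset.smul_sum, smul_eq_C_mul, mul_assoc]

/-- For `i ≤ n - m` and `j < n + m` one has `i + j < 2n`, so discrete orthogonality keeps only `j =
i`, where the filter is 1. -/
theorem vpInterp_orthoPoly (w : ChebKind) {n m i : ℕ} (hm : 0 < m) (hmn : m < n) (hi : i ≤ n - m) :
    vpInterp w n m (fun x => (w.orthoPoly i).eval x) = w.orthoPoly i := by
  have e : vpInterp w n m (fun x => (w.orthoPoly i).eval x) =
      ∑ j ∈ Finset.range (n + m), C (vpFilter n m j * ∑ k ∈ Finset.Icc 1 n,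
        w.christoffel n k * ((w.orthoPoly i).eval (w.node n k) *
          (w.orthoPoly j).eval (w.node n k))) * w.orthoPoly j := by
    simp only [vpInterp, vpFundamental, Finset.mul_sum, map_sum, Finset.sum_mul]
    rw [Finset.sum_comm]
    refine Finset.sum_congr rfl fun j _ => Finset.sum_congr rfl fun k _ => ?_
    simp only [C_mul]
    ring
  rw [e, Finset.sum_eq_single i]
  · rw [w.sum_christoffel_mul (by omega) (by omega), if_pos rfl, vpFilter, if_pos hi]
    simp
  · intro j hj hji
    rw [w.sum_christoffel_mul (by omega) (by have := Finset.mem_range.1 hj; omega),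
      if_neg hji.symm]
    simp
  · intro h
    exact absurd (Finset.mem_range.2 (by omega)) h

/-- The VP interpolation reproduces polynomials of degree at most `n - m`. -/
theorem vpInterp_eval_eq_self (w : ChebKind) {n m : ℕ} (hm : 0 < m) (hmn : m < n) {P : ℝ[X]}
    (hP : P.natDegree ≤ n - m) : vpInterp w n m (fun x => P.eval x) = P := by
  let S : Submodule ℝ ℝ[X] :=
    { carrier := {Q | vpInterp w n m (fun x => Q.eval x) = Q}
      add_mem' := fun {Q R} hQ hR => by
        simp only [Set.mem_ofPred_eq, eval_add] at *
        rw [vpInterp_add, hQ, hR]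
      zero_mem' := by simp [vpInterp]
      smul_mem' := fun a Q hQ => by
        simp only [Set.mem_ofPred_eq, eval_smul, smul_eq_mul] at *
        rw [vpInterp_smul, hQ] }
  have h := w.orthoPoly_isOrthonormal
  exact mem_of_natDegree_le (S := S) h.natDegree_eq h.leadingCoeff_pos
    (fun i hi => vpInterp_orthoPoly w hm hmn hi) hP

theorem natDegree_vpInterp_le (w : ChebKind) (n m : ℕ) (f : ℝ → ℝ) :
    (vpInterp w n m f).natDegree ≤ n + m - 1 := by
  refine natDegree_sum_le_of_forall_le _ _ fun k _ => (natDegree_C_mul_le _ _).trans ?_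
  refine (natDegree_C_mul_le _ _).trans ?_
  refine natDegree_sum_le_of_forall_le _ _ fun j hj => (natDegree_C_mul_le _ _).trans ?_
  rw [w.orthoPoly_isOrthonormal.natDegree_eq]
  have := Finset.mem_range.1 hj
  omega

/-! ### Closed form of the de la Vallée Poussin kernel. -/

/-- Induction step exhibiting the trapezoidal filter as a sum of `M` consecutive partial sums, those
of lengths `L + 1` to `L + M`. -/
theorem sum_min_mul_succ (c : ℕ → ℝ) (L M : ℕ) :
    ∑ j ∈ Finset.range (L + (M + 1)), min ((M + 1 : ℕ) : ℝ) (L + (M + 1 : ℕ) - j) * c j =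
      ∑ j ∈ Finset.range (L + M), min (M : ℝ) (L + M - j) * c j +
        ∑ j ∈ Finset.range (L + M + 1), c j := by
  rw [← add_assoc, Finset.sum_range_succ, Finset.sum_range_succ c, ← add_assoc,
    ← Finset.sum_add_distrib]
  congr 1
  · refine Finset.sum_congr rfl fun j _ => ?_
    have : min ((M + 1 : ℕ) : ℝ) (L + (M + 1 : ℕ) - j) = min (M : ℝ) (L + M - j) + 1 := by
      rw [← min_add_add_right]; push_cast; congr 1; ring
    rw [this]; ring
  · have : min ((M + 1 : ℕ) : ℝ) (L + (M + 1 : ℕ) - (L + M : ℕ)) = 1 := by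
      push_cast
      rw [min_eq_right] <;> ring_nf
      have : (0 : ℝ) ≤ M := by positivity
      linarith
    rw [this, one_mul]

theorem two_mul_sin_half_mul_sum_cos_range (q : ℕ) (a x : ℝ) :
    2 * sin (x / 2) * ∑ j ∈ Finset.range q, cos ((j + a) * x) =
      sin ((q + a - 1 / 2) * x) - sin ((a - 1 / 2) * x) := by
  induction q with
  | zero => simp
  | succ n ih =>
    rw [Finset.sum_range_succ, mul_add, ih]
    have := sin_sub_sin ((n + 1 + a - 1 / 2) * x) ((n + a - 1 / 2) * x)
    rw [show ((n + 1 + a - 1 / 2) * x - (n + a - 1 / 2) * x) / 2 = x / 2 by ring,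
      show ((n + 1 + a - 1 / 2) * x + (n + a - 1 / 2) * x) / 2 = (n + a) * x by ring] at this
    push_cast
    linarith

theorem four_mul_sin_sq_mul_sum_min_mul_cos (L M : ℕ) (a x : ℝ) :
    4 * sin (x / 2) ^ 2 *
        ∑ j ∈ Finset.range (L + M), min (M : ℝ) (L + M - j) * cos ((j + a) * x) =
      cos ((L + a) * x) - cos ((L + M + a) * x) -
        2 * M * sin (x / 2) * sin ((a - 1 / 2) * x) := by
  induction M with
  | zero =>
    simp only [Nat.cast_zero, add_zero, sub_self, mul_zero, zero_mul]
    rw [Finset.sum_eq_zero, mul_zero]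
    intro j hj
    have : (j : ℝ) < L := by exact_mod_cast Finset.mem_range.1 hj
    rw [min_eq_left (by linarith), zero_mul]
  | succ M ih =>
    rw [sum_min_mul_succ, mul_add, ih]
    have h := two_mul_sin_half_mul_sum_cos_range (L + M + 1) a x
    have h2 := ChebKind.two_mul_sin_mul_sin_eq (x / 2) ((L + M + 1 + a - 1 / 2) * x)
    rw [← cos_neg (x / 2 - (L + M + 1 + a - 1 / 2) * x),
      show -(x / 2 - (L + M + 1 + a - 1 / 2) * x) = (L + M + a) * x by ring,
      show x / 2 + (L + M + 1 + a - 1 / 2) * x = (L + (M + 1) + a) * x by ring] at h2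
    push_cast at h ⊢
    linear_combination 2 * sin (x / 2) * h + h2

/-- The de la Vallée Poussin kernel. -/
noncomputable def vpKernel (n m : ℕ) (a x : ℝ) : ℝ :=
  ∑ j ∈ Finset.range (n + m), vpFilter n m j * cos ((j + a) * x) + (a - 1 / 2)

theorem two_mul_mul_vpFilter {n m : ℕ} (hm : 0 < m) (hmn : m < n) (j : ℕ) :
    2 * m * vpFilter n m j = min (2 * m : ℝ) (n + m - j) := by
  have hm' : (0 : ℝ) < m := by exact_mod_cast hm
  rw [vpFilter]
  split_ifs with h
  · have : (j : ℝ) + m ≤ n := by exact_mod_cast (by omega : j + m ≤ n)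
    rw [min_eq_left (by linarith), mul_one]
  · have : (n : ℝ) < j + m := by exact_mod_cast (by omega : n < j + m)
    rw [min_eq_right (by linarith)]
    field_simp

/-- The constant `a - 1/2` in `vpKernel` cancels the boundary term of the summation formula; the
difference of cosines left over is a product of two sines. The condition on `a` holds for every
`shift`, by `sin_shift_sub_half_mul`. -/
theorem four_mul_sin_sq_mul_vpKernel {n m : ℕ} (hm : 0 < m) (hmn : m < n) {a x : ℝ}
    (ha : sin ((a - 1 / 2) * x) = (2 * a - 1) * sin (x / 2)) :
    4 * m * sin (x / 2) ^ 2 * vpKernel n m a x = sin ((n + a) * x) * sin (m * x) := by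
  have h := four_mul_sin_sq_mul_sum_min_mul_cos (n - m) (2 * m) a x
  have hc : ((n - m : ℕ) : ℝ) = n - m := Nat.cast_sub hmn.le
  have e : ∑ j ∈ Finset.range (n - m + 2 * m),
      min ((2 * m : ℕ) : ℝ) ((n - m : ℕ) + (2 * m : ℕ) - j) * cos ((j + a) * x) =
      2 * m * ∑ j ∈ Finset.range (n + m), vpFilter n m j * cos ((j + a) * x) := by
    rw [Finset.mul_sum, show n - m + 2 * m = n + m by omega]
    refine Finset.sum_congr rfl fun j _ => ?_
    rw [← mul_assoc, two_mul_mul_vpFilter hm hmn, hc]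
    push_cast
    ring_nf
  rw [e, ha, hc] at h
  have h2 := ChebKind.two_mul_sin_mul_sin_eq ((n + a) * x) (m * x)
  rw [show (n + a) * x - m * x = (n - m + a) * x by ring,
    show (n + a) * x + m * x = (n - m + 2 * m + a) * x by ring] at h2
  rw [vpKernel]
  push_cast at h
  linear_combination h / 2 - h2 / 2

theorem abs_vpFilter_le_one {n m j : ℕ} (hm : 0 < m) (hmn : m < n) (hj : j < n + m) :
    |vpFilter n m j| ≤ 1 := by
  have hm' : (0 : ℝ) < m := by exact_mod_cast hm
  have h := two_mul_mul_vpFilter hm hmn j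
  have hj' : (j : ℝ) < n + m := by exact_mod_cast hj
  have h1 : min (2 * m : ℝ) (n + m - j) ≤ 2 * m := min_le_left _ _
  have h2 : 0 < min (2 * m : ℝ) (n + m - j) := lt_min (by linarith) (by linarith)
  rw [abs_le]
  constructor <;> nlinarith

namespace ChebKind

/-- The filtered kernel of the trigonometric system. -/
noncomputable def filteredKernel (w : ChebKind) (n m : ℕ) (s t : ℝ) : ℝ :=
  ∑ j ∈ Finset.range (n + m), vpFilter n m j * (w.trig j s * w.trig j t)

theorem sin_shift_sub_half_mul (w : ChebKind) (x : ℝ) :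
    sin ((w.shift - 1 / 2) * x) = (2 * w.shift - 1) * sin (x / 2) := by
  cases w <;> simp only [shift]
  · rw [show (0 - 1 / 2) * x = -(x / 2) by ring, sin_neg]; ring
  · rw [show (1 - 1 / 2) * x = x / 2 by ring]; ring
  · simp
  · simp

/-- Product-to-sum formulas. The constants of the two kernels cancel for sines. For `w1` they
account for the halved term `j = 0`, and for `w3` they are zero. -/
theorem two_mul_filteredKernel (w : ChebKind) {n m : ℕ} (hn : 0 < n) (s t : ℝ) :
    2 * w.filteredKernel n m s t =
      vpKernel n m w.shift (s - t) + w.parity * vpKernel n m w.shift (s + t) := by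
  have hcos : ∀ a : ℝ, 2 * ∑ j ∈ Finset.range (n + m), vpFilter n m j *
      (cos ((j + a) * s) * cos ((j + a) * t)) + 2 * (a - 1 / 2) =
      vpKernel n m a (s - t) + 1 * vpKernel n m a (s + t) := by
    intro a
    have e : 2 * ∑ j ∈ Finset.range (n + m), vpFilter n m j *
        (cos ((j + a) * s) * cos ((j + a) * t)) =
        ∑ j ∈ Finset.range (n + m), vpFilter n m j * cos ((j + a) * (s - t)) +
        ∑ j ∈ Finset.range (n + m), vpFilter n m j * cos ((j + a) * (s + t)) := by
      rw [Finset.mul_sum, ← Finset.sum_add_distrib]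
      refine Finset.sum_congr rfl fun j _ => ?_
      have := two_mul_cos_mul_cos_eq ((j + a) * s) ((j + a) * t)
      rw [← mul_sub, ← mul_add] at this
      linear_combination vpFilter n m j * this
    rw [e, vpKernel, vpKernel]
    ring
  have hsin : ∀ a : ℝ, 2 * ∑ j ∈ Finset.range (n + m), vpFilter n m j *
      (sin ((j + a) * s) * sin ((j + a) * t)) =
      vpKernel n m a (s - t) + (-1) * vpKernel n m a (s + t) := by
    intro a
    have e : 2 * ∑ j ∈ Finset.range (n + m), vpFilter n m j *
        (sin ((j + a) * s) * sin ((j + a) * t)) =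
        ∑ j ∈ Finset.range (n + m), vpFilter n m j * cos ((j + a) * (s - t)) -
        ∑ j ∈ Finset.range (n + m), vpFilter n m j * cos ((j + a) * (s + t)) := by
      rw [Finset.mul_sum, ← Finset.sum_sub_distrib]
      refine Finset.sum_congr rfl fun j _ => ?_
      have := two_mul_sin_mul_sin_eq ((j + a) * s) ((j + a) * t)
      rw [← mul_sub, ← mul_add] at this
      linear_combination vpFilter n m j * this
    rw [e, vpKernel, vpKernel]
    ring
  cases w <;> simp only [filteredKernel, trig, shift, parity]
  · rw [← hcos 0]
    obtain ⟨N, hN⟩ : ∃ N, n + m = N + 1 := ⟨n + m - 1, by omega⟩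
    have h2 : √2 * √2 = 2 := mul_self_sqrt (by norm_num)
    rw [hN, Finset.sum_range_succ', Finset.sum_range_succ']
    simp [vpFilter, ← mul_inv, h2]
    ring
  · exact hsin 1
  · rw [← hcos (1 / 2)]; ring
  · exact hsin (1 / 2)

/-- Reflection multiplies both factors of the `j`-th term by the same sign, and it exchanges the
third and fourth kinds. -/
theorem filteredKernel_eq_reflect (w : ChebKind) (n m : ℕ) (s t : ℝ) :
    w.filteredKernel n m s t =
      (match w with
        | w1 => w1
        | w2 => w2
        | w3 => w4
        | w4 => w3 : ChebKind).filteredKernel n m (π - s) (π - t) := by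
  refine Finset.sum_congr rfl fun j _ => ?_
  have hsq : cos (j * π) * cos (j * π) = 1 := by
    have h := sin_sq_add_cos_sq (j * π)
    rw [sin_nat_mul_pi] at h
    linarith
  have hs0 := sin_nat_mul_pi j
  congr 1
  cases w <;> simp only [trig]
  · split_ifs
    · rfl
    · have e : ∀ x : ℝ, cos (j * (π - x)) = cos (j * π) * cos (j * x) := by
        intro x; rw [mul_sub, cos_sub, hs0]; ring
      rw [e, e]
      linear_combination (-cos (j * s) * cos (j * t)) * hsq
  · have e : ∀ x : ℝ, sin ((j + 1) * (π - x)) = cos (j * π) * sin ((j + 1) * x) := by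
      intro x
      rw [show (j + 1) * (π - x) = j * π + (π - (j + 1) * x) by ring, sin_add, sin_pi_sub, hs0]
      ring
    rw [e, e]
    linear_combination (-sin ((j + 1) * s) * sin ((j + 1) * t)) * hsq
  · have e : ∀ x : ℝ, sin ((j + 1 / 2) * (π - x)) = cos (j * π) * cos ((j + 1 / 2) * x) := by
      intro x
      rw [show (j + 1 / 2) * (π - x) = j * π + (π / 2 - (j + 1 / 2) * x) by ring, sin_add,
        sin_pi_div_two_sub, hs0]
      ring
    rw [e, e]
    linear_combination (-cos ((j + 1 / 2) * s) * cos ((j + 1 / 2) * t)) * hsq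
  · have e : ∀ x : ℝ, cos ((j + 1 / 2) * (π - x)) = cos (j * π) * sin ((j + 1 / 2) * x) := by
      intro x
      rw [show (j + 1 / 2) * (π - x) = j * π + (π / 2 - (j + 1 / 2) * x) by ring, cos_add,
        cos_pi_div_two_sub, hs0]
      ring
    rw [e, e]
    linear_combination (-sin ((j + 1 / 2) * s) * sin ((j + 1 / 2) * t)) * hsq

end ChebKind

/-! ### Decay of the kernel and its vanishing at the endpoints. -/

namespace ChebKind

theorem shift_nonneg (w : ChebKind) : 0 ≤ w.shift := by
  cases w <;> simp only [shift] <;> norm_num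

theorem shift_le_one (w : ChebKind) : w.shift ≤ 1 := by
  cases w <;> simp only [shift] <;> norm_num

theorem le_mul_sin_half {t : ℝ} (ht : t ∈ Set.Ioo 0 π) : t ≤ π * sin (t / 2) := by
  have hpi := pi_pos
  have h := mul_le_sin (x := t / 2) (by linarith [ht.1]) (by linarith [ht.2])
  rw [div_mul_div_comm, div_le_iff₀ (by positivity)] at h
  linarith

theorem abs_filteredKernel_le (w : ChebKind) {n m : ℕ} (hm : 0 < m) (hmn : m < n) {s t B : ℝ}
    (hB : ∀ j < n + m, |w.trig j t| ≤ B) : |w.filteredKernel n m s t| ≤ (n + m) * B := by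
  have h : ∀ j ∈ Finset.range (n + m), |vpFilter n m j * (w.trig j s * w.trig j t)| ≤ B := by
    intro j hj
    have hj := Finset.mem_range.1 hj
    rw [abs_mul, abs_mul]
    have h1 := abs_vpFilter_le_one hm hmn hj
    have h2 := w.abs_trig_le_one j s
    calc _ ≤ 1 * (1 * |w.trig j t|) := by gcongr
      _ ≤ B := by rw [one_mul, one_mul]; exact hB j hj
  calc _ ≤ _ := Finset.abs_sum_le_sum_abs _ _
    _ ≤ _ := Finset.sum_le_card_nsmul _ _ _ h
    _ = _ := by simp

theorem sin_half_add_sq_sub (s t : ℝ) :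
    sin ((s + t) / 2) ^ 2 - sin ((s - t) / 2) ^ 2 = sin s * sin t := by
  have h1 := cos_sq' ((s + t) / 2)
  have h2 := cos_sq' ((s - t) / 2)
  have h3 := cos_two_mul ((s + t) / 2)
  have h4 := cos_two_mul ((s - t) / 2)
  rw [show 2 * ((s + t) / 2) = s + t by ring] at h3
  rw [show 2 * ((s - t) / 2) = s - t by ring] at h4
  linarith [two_mul_sin_mul_sin_eq s t]

theorem abs_sin_half_sub_comm (s t : ℝ) : |sin ((t - s) / 2)| = |sin ((s - t) / 2)| := by
  rw [← abs_neg, ← sin_neg]; ring_nf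

/-- The reflected kernel is no worse than the direct one, since `sin² ((s + t) / 2) - sin² ((s - t)
/ 2) = sin s sin t ≥ 0`. -/
theorem mul_sq_mul_abs_filteredKernel_le (w : ChebKind) {n m : ℕ} (hm : 0 < m) (hmn : m < n)
    {s t : ℝ} (hs : s ∈ Set.Ioo 0 π) (ht : t ∈ Set.Ioo 0 π) :
    4 * m * sin ((s - t) / 2) ^ 2 * |w.filteredKernel n m s t| ≤ 1 := by
  have hm' : (0 : ℝ) < m := by exact_mod_cast hm
  have h1 := four_mul_sin_sq_mul_vpKernel hm hmn (w.sin_shift_sub_half_mul (s - t))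
  have h2 := four_mul_sin_sq_mul_vpKernel hm hmn (w.sin_shift_sub_half_mul (s + t))
  have hD := w.two_mul_filteredKernel (m := m) (by omega : 0 < n) s t
  have hss := sin_half_add_sq_sub s t
  have h0 : 0 ≤ sin s * sin t :=
    (mul_pos (sin_pos_of_pos_of_lt_pi hs.1 hs.2) (sin_pos_of_pos_of_lt_pi ht.1 ht.2)).le
  have hA : ∀ x, |sin ((n + w.shift) * x) * sin (m * x)| ≤ 1 := fun x => by
    rw [abs_mul]; exact mul_le_one₀ (abs_sin_le_one _) (abs_nonneg _) (abs_sin_le_one _)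
  have h1' := hA (s - t)
  have h2' := hA (s + t)
  rw [← h1, abs_mul, abs_of_nonneg (by positivity)] at h1'
  rw [← h2, abs_mul, abs_of_nonneg (by positivity)] at h2'
  have hp : |w.parity| = 1 := by cases w <;> simp [parity]
  have h3 : 2 * |w.filteredKernel n m s t| ≤
      |vpKernel n m w.shift (s - t)| + |vpKernel n m w.shift (s + t)| := by
    have : 2 * |w.filteredKernel n m s t| = |2 * w.filteredKernel n m s t| := by
      rw [abs_mul, abs_two]
    rw [this, hD]
    refine (abs_add_le _ _).trans ?_
    rw [abs_mul, hp, one_mul]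
  have h4 : 4 * m * sin ((s - t) / 2) ^ 2 * |vpKernel n m w.shift (s + t)| ≤
      4 * m * sin ((s + t) / 2) ^ 2 * |vpKernel n m w.shift (s + t)| := by
    gcongr 4 * (m : ℝ) * ?_ * _
    linarith
  have h5 := mul_le_mul_of_nonneg_left h3
    (by positivity : 0 ≤ 4 * (m : ℝ) * sin ((s - t) / 2) ^ 2)
  linarith

/-- Combines the trivial bound `n + m` with the bound away from the diagonal, where `n ≤ c m` makes
`m` comparable to `ν`. The constant is generous so as to coincide with that of
`abs_filteredKernel_mul_le_sin`. -/
theorem abs_filteredKernel_mul_le (w : ChebKind) {n m : ℕ} {c : ℝ} (hm : 0 < m) (hmn : m < n)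
    (hc : (n : ℝ) ≤ c * m) {s t : ℝ} (hs : s ∈ Set.Ioo 0 π) (ht : t ∈ Set.Ioo 0 π) :
    |w.filteredKernel n m s t| * (1 + (n + w.shift) * |sin ((t - s) / 2)|) ^ 2 ≤
      (320 + 6 * c) * (n + w.shift) := by
  have h0 := w.shift_nonneg
  have h1 := w.shift_le_one
  have hm' : (1 : ℝ) ≤ m := by exact_mod_cast hm
  have hmn' : (m : ℝ) + 1 ≤ n := by exact_mod_cast hmn
  have hc0 : 0 < c := by by_contra h; nlinarith
  have hD1 := w.abs_filteredKernel_le (s := s) hm hmn fun j _ => w.abs_trig_le_one j t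
  have hD2 := w.mul_sq_mul_abs_filteredKernel_le hm hmn hs ht
  rw [abs_sin_half_sub_comm s t, ← sq_abs (sin _)] at *
  set d := |sin ((s - t) / 2)|
  set D := |w.filteredKernel n m s t|
  have hD0 : 0 ≤ D := abs_nonneg _
  have hd0 : 0 ≤ d := abs_nonneg _
  set ν := n + w.shift
  have hν : ν ≤ 2 * c * m := by
    have : ν ≤ 2 * n := by simp only [ν]; linarith
    linarith
  have hν0 : 0 < ν := by simp only [ν]; linarith
  have hnm : (n + m : ℝ) * 1 ≤ 2 * ν := by simp only [ν]; linarith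
  have h3 : ν * (ν * (d ^ 2 * D)) ≤ ν * (c / 2) := by
    gcongr
    have : ν * (d ^ 2 * D) ≤ 2 * c * m * (d ^ 2 * D) := by gcongr
    nlinarith
  have h4 : D * (1 + ν * d) ^ 2 ≤ 2 * D + 2 * (ν * (ν * (d ^ 2 * D))) := by
    nlinarith [mul_nonneg hD0 (sq_nonneg (1 - ν * d))]
  nlinarith

theorem sin_mul_sin_le_four_mul {s t : ℝ} (hs : 0 ≤ sin (s / 2)) (ht : 0 ≤ sin (t / 2)) :
    sin s * sin t ≤ 4 * (sin (s / 2) * sin (t / 2)) := by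
  have e : ∀ x : ℝ, sin x = 2 * sin (x / 2) * cos (x / 2) := fun x => by
    rw [← sin_two_mul]; ring_nf
  rw [e s, e t]
  have h1 : cos (s / 2) * cos (t / 2) ≤ 1 := by
    refine (le_abs_self _).trans ?_
    rw [abs_mul]
    exact mul_le_one₀ (abs_cos_le_one _) (abs_nonneg _) (abs_cos_le_one _)
  nlinarith [mul_nonneg hs ht]

theorem abs_sin_mul_sin_sub_le (p q s t : ℝ) (hp : 0 ≤ p) (hq : 0 ≤ q) (ht : 0 ≤ t) :
    |sin (p * (s - t)) * sin (q * (s - t)) - sin (p * (s + t)) * sin (q * (s + t))| ≤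
      2 * (p + q) * t := by
  have h : ∀ r : ℝ, 0 ≤ r → |sin (r * (s - t)) - sin (r * (s + t))| ≤ 2 * r * t := by
    intro r hr
    have e := sin_sub_sin (r * (s - t)) (r * (s + t))
    rw [show (r * (s - t) - r * (s + t)) / 2 = -(r * t) by ring] at e
    rw [e, abs_mul, abs_mul, abs_two]
    have h1 : |sin (-(r * t))| ≤ r * t := by
      rw [sin_neg, abs_neg]
      exact (abs_sin_le_abs (x := r * t)).trans_eq (abs_of_nonneg (by positivity))
    have := abs_cos_le_one ((r * (s - t) + r * (s + t)) / 2)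
    calc _ ≤ 2 * (r * t) * 1 := by gcongr
      _ = _ := by ring
  have e : sin (p * (s - t)) * sin (q * (s - t)) - sin (p * (s + t)) * sin (q * (s + t)) =
      (sin (p * (s - t)) - sin (p * (s + t))) * sin (q * (s - t)) +
      (sin (q * (s - t)) - sin (q * (s + t))) * sin (p * (s + t)) := by ring
  rw [e]
  refine (abs_add_le _ _).trans ?_
  rw [abs_mul, abs_mul]
  have h1 := mul_le_of_le_one_right (abs_nonneg (sin (p * (s - t)) - sin (p * (s + t))))
    (abs_sin_le_one (q * (s - t)))
  have h2 := mul_le_of_le_one_right (abs_nonneg (sin (q * (s - t)) - sin (q * (s + t))))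
    (abs_sin_le_one (p * (s + t)))
  linarith [h p hp, h q hq]

theorem abs_trig_le_mul (w : ChebKind) (hw : w = w2 ∨ w = w4) (j : ℕ) {t : ℝ} (ht : 0 ≤ t) :
    |w.trig j t| ≤ (j + w.shift) * t := by
  have h : ∀ a : ℝ, 0 ≤ a → |sin ((j + a) * t)| ≤ (j + a) * t := fun a ha =>
    (abs_sin_le_abs (x := (j + a) * t)).trans_eq (abs_of_nonneg (by positivity))
  rcases hw with rfl | rfl <;> simp only [trig, shift] <;> exact h _ (by norm_num)

/-- Here `8 m D = A / d² - A' / e` is the difference of the direct and the reflected kernel. Both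
the change of numerator and the change of denominator are proportional to `σ = sin (t/2)`, which
yields the extra factor `ν σ`. -/
theorem abs_mul_sq_le_of_far {m ν d σ D e A A' c : ℝ} (hc : 0 < c) (hm : 0 < m) (hν : 0 < ν)
    (hd : 0 < d) (hσ : 0 < σ) (hνd : 4 ≤ ν * d) (hνm : ν ≤ 2 * c * m) (hde : d ^ 2 ≤ e)
    (h : 8 * m * d ^ 2 * (e * D) = d ^ 2 * (A - A') + (e - d ^ 2) * A) (hA : |A| ≤ 1)
    (hAA : |A - A'| ≤ 51 / 4 * (ν * σ)) (he : e - d ^ 2 ≤ 5 * d * σ) :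
    |D| * (1 + ν * d) ^ 2 ≤ (320 + 6 * c) * ν * (ν * σ) := by
  have hD0 := abs_nonneg D
  have h4 : 8 * m * d ^ 2 * (e * |D|) ≤ d ^ 2 * (14 * (ν * σ)) := by
    have e2 : 8 * m * d ^ 2 * (e * |D|) = |8 * m * d ^ 2 * (e * D)| := by
      rw [abs_mul, abs_mul e, abs_of_nonneg (by positivity : 0 ≤ 8 * m * d ^ 2),
        abs_of_nonneg ((sq_nonneg d).trans hde)]
    rw [e2, h]
    refine (abs_add_le _ _).trans ?_
    rw [abs_mul, abs_mul, abs_of_nonneg (sq_nonneg d), abs_of_nonneg (by linarith : 0 ≤ e - d ^ 2)]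
    have h6 : (e - d ^ 2) * |A| ≤ 5 / 4 * d ^ 2 * (ν * σ) := by
      calc (e - d ^ 2) * |A| ≤ (e - d ^ 2) * 1 :=
            mul_le_mul_of_nonneg_left hA (by linarith)
        _ ≤ 5 * d * σ := by linarith
        _ ≤ 5 / 4 * d ^ 2 * (ν * σ) := by
            have := mul_le_mul_of_nonneg_left hνd (by positivity : 0 ≤ 5 / 4 * (d * σ))
            linarith
    have h8 := mul_le_mul_of_nonneg_left hAA (sq_nonneg d)
    linarith
  have h5 : 8 * m * d ^ 2 * |D| ≤ 14 * (ν * σ) := by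
    refine le_of_mul_le_mul_left (le_trans ?_ h4) (by positivity : 0 < d ^ 2)
    calc d ^ 2 * (8 * m * d ^ 2 * |D|) = 8 * m * d ^ 2 * (d ^ 2 * |D|) := by ring
      _ ≤ _ := by gcongr
  have h6 : (1 + ν * d) ^ 2 ≤ 25 / 16 * (ν * d) ^ 2 := by nlinarith
  have h7 : ν * (d ^ 2 * |D|) ≤ 7 / 2 * c * (ν * σ) := by
    have : ν * (d ^ 2 * |D|) ≤ 2 * c * m * (d ^ 2 * |D|) := by gcongr
    have := mul_le_mul_of_nonneg_left h5 hc.le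
    linarith
  calc |D| * (1 + ν * d) ^ 2 ≤ |D| * (25 / 16 * (ν * d) ^ 2) := by gcongr
    _ = 25 / 16 * ν * (ν * (d ^ 2 * |D|)) := by ring
    _ ≤ 25 / 16 * ν * (7 / 2 * c * (ν * σ)) := by gcongr
    _ ≤ (320 + 6 * c) * ν * (ν * σ) := by
        have : 0 < ν * (ν * σ) := by positivity
        have : 0 < c * (ν * (ν * σ)) := by positivity
        linarith

/-- The kernels built from sines vanish at the left endpoint of the angular interval. -/
theorem abs_filteredKernel_mul_le_sin (w : ChebKind) (hw : w = w2 ∨ w = w4) {n m : ℕ} {c : ℝ}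
    (hm : 0 < m) (hmn : m < n) (hc : (n : ℝ) ≤ c * m) {s t : ℝ} (hs : s ∈ Set.Ioo 0 π)
    (ht : t ∈ Set.Ioo 0 π) :
    |w.filteredKernel n m s t| * (1 + (n + w.shift) * |sin ((t - s) / 2)|) ^ 2 ≤
      (320 + 6 * c) * (n + w.shift) * ((n + w.shift) * sin (t / 2)) := by
  have hpi := pi_lt_d2
  have hpi0 := pi_pos
  have h0 := w.shift_nonneg
  have h1 := w.shift_le_one
  have hm' : (1 : ℝ) ≤ m := by exact_mod_cast hm
  have hmn' : (m : ℝ) + 1 ≤ n := by exact_mod_cast hmn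
  have hc0 : 0 < c := by by_contra h; nlinarith
  have hK1 := w.abs_filteredKernel_mul_le hm hmn hc hs ht
  set ν := n + w.shift with hνdef
  have hν : ν ≤ 2 * c * m := by linarith
  have hν0 : 0 < ν := by linarith
  have hσ : 0 < sin (t / 2) := sin_pos_of_pos_of_lt_pi (by linarith [ht.1]) (by linarith [ht.2])
  have hσs : 0 < sin (s / 2) := sin_pos_of_pos_of_lt_pi (by linarith [hs.1]) (by linarith [hs.2])
  have htσ := le_mul_sin_half ht
  -- If `ν sin (t/2) ≥ 1` the extra factor costs nothing.
  rcases le_total 1 (ν * sin (t / 2)) with hbig | hsmall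
  · refine hK1.trans ?_
    exact le_mul_of_one_le_right (by positivity) hbig
  have hsd := sin_half_le_add t s hσ.le
  have hD2 := w.two_mul_filteredKernel (m := m) (by omega : 0 < n) s t
  have hp : w.parity = -1 := by rcases hw with rfl | rfl <;> rfl
  have g1 := four_mul_sin_sq_mul_vpKernel hm hmn (w.sin_shift_sub_half_mul (s - t))
  have g2 := four_mul_sin_sq_mul_vpKernel hm hmn (w.sin_shift_sub_half_mul (s + t))
  have hAB := abs_sin_mul_sin_sub_le ν m s t hν0.le (by linarith) ht.1.le
  have hss := sin_half_add_sq_sub s t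
  have hss2 := sin_mul_sin_le_four_mul hσs.le hσ.le
  have hss0 : 0 ≤ sin s * sin t :=
    (mul_pos (sin_pos_of_pos_of_lt_pi hs.1 hs.2) (sin_pos_of_pos_of_lt_pi ht.1 ht.2)).le
  have hA1 : |sin (ν * (s - t)) * sin (m * (s - t))| ≤ 1 := by
    rw [abs_mul]; exact mul_le_one₀ (abs_sin_le_one _) (abs_nonneg _) (abs_sin_le_one _)
  have htriv := w.abs_filteredKernel_le (s := s) (t := t) (B := 2 * ν * t) hm hmn fun j hj => by
    refine (w.abs_trig_le_mul hw j ht.1.le).trans ?_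
    have : (j : ℝ) ≤ n + m := by exact_mod_cast hj.le
    exact mul_le_mul_of_nonneg_right (by linarith) ht.1.le
  rw [← hνdef] at g1 g2
  rw [hp] at hD2
  rw [abs_sin_half_sub_comm s t] at *
  rw [← sq_abs (sin ((s - t) / 2))] at *
  have hd0 : 0 ≤ |sin ((s - t) / 2)| := abs_nonneg _
  set d := |sin ((s - t) / 2)|
  set σ := sin (t / 2)
  set A := sin (ν * (s - t)) * sin (m * (s - t))
  set A' := sin (ν * (s + t)) * sin (m * (s + t))
  set D := w.filteredKernel n m s t
  set e := sin ((s + t) / 2) ^ 2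
  have hD0 : 0 ≤ |D| := abs_nonneg D
  -- Near the diagonal, bounding each sine by its argument suffices; `320` comes from `25 · 4π`.
  -- Away from it, `ν σ ≤ 1` gives `σ ≤ d / 4`, hence `sin (s/2) ≤ 5 d / 4`, and the two kernels
  -- cancel.
  rcases le_total (ν * d) 4 with hd | hd
  · have hX : (1 + ν * d) ^ 2 ≤ 25 := by nlinarith [mul_nonneg hν0.le hd0]
    have h3 : |D| ≤ 4 * π * (ν * (ν * σ)) := by
      calc |D| ≤ (n + m) * (2 * ν * t) := htriv
        _ ≤ (2 * ν) * (2 * ν * (π * σ)) := by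
            have := ht.1
            gcongr
            linarith
        _ = _ := by ring
    have hpos : 0 < ν * (ν * σ) := by positivity
    calc |D| * (1 + ν * d) ^ 2 ≤ (4 * π * (ν * (ν * σ))) * 25 := by gcongr
      _ ≤ (320 + 6 * c) * ν * (ν * σ) := by nlinarith
  · have hd1 : 0 < d := by
      by_contra h
      have : d = 0 := le_antisymm (not_lt.1 h) hd0
      rw [this] at hd; linarith
    have hσd : σ ≤ d / 4 := by
      have : ν * σ ≤ ν * (d / 4) := by linarith
      exact le_of_mul_le_mul_left this hν0
    have hde : d ^ 2 ≤ e := by linarith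
    have e1 : 8 * m * d ^ 2 * (e * D) = d ^ 2 * (A - A') + (e - d ^ 2) * A := by
      linear_combination 4 * m * d ^ 2 * e * hD2 + e * g1 - d ^ 2 * g2
    refine abs_mul_sq_le_of_far (A := A) (A' := A') hc0 (by linarith) hν0 hd1 hσ hd hν hde e1 hA1
      ?_ ?_
    · calc _ ≤ 2 * (ν + m) * t := hAB
        _ ≤ 2 * (ν + ν) * (π * σ) := by
            have := ht.1
            gcongr
            linarith
        _ = 4 * π * (ν * σ) := by ring
        _ ≤ 51 / 4 * (ν * σ) := by gcongr; linarith
    · have h9 : sin (s / 2) ≤ 5 / 4 * d := by linarith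
      have := mul_le_mul_of_nonneg_right h9 hσ.le
      linarith

/-- The kernels of the second and third kind vanish at the right endpoint. -/
theorem abs_filteredKernel_mul_le_cos (w : ChebKind) (hw : w = w2 ∨ w = w3) {n m : ℕ} {c : ℝ}
    (hm : 0 < m) (hmn : m < n) (hc : (n : ℝ) ≤ c * m) {s t : ℝ} (hs : s ∈ Set.Ioo 0 π)
    (ht : t ∈ Set.Ioo 0 π) :
    |w.filteredKernel n m s t| * (1 + (n + w.shift) * |sin ((t - s) / 2)|) ^ 2 ≤
      (320 + 6 * c) * (n + w.shift) * ((n + w.shift) * cos (t / 2)) := by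
  have hs' : π - s ∈ Set.Ioo 0 π := ⟨by linarith [hs.2], by linarith [hs.1]⟩
  have ht' : π - t ∈ Set.Ioo 0 π := ⟨by linarith [ht.2], by linarith [ht.1]⟩
  have e : (π - t - (π - s)) / 2 = (s - t) / 2 := by ring
  rw [filteredKernel_eq_reflect, abs_sin_half_sub_comm]
  rcases hw with rfl | rfl
  · have := abs_filteredKernel_mul_le_sin w2 (.inl rfl) hm hmn hc hs' ht'
    rwa [e, sub_div π t, sin_pi_div_two_sub] at this
  · have := abs_filteredKernel_mul_le_sin w4 (.inr rfl) hm hmn hc hs' ht'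
    rwa [e, sub_div π t, sin_pi_div_two_sub] at this

end ChebKind

/-! ### The weighted Lebesgue function. -/

namespace ChebKind

/-- The exponent of `sin (t / 2)` in `root`. -/
noncomputable def sinExponent : ChebKind → ℝ
  | w1 => 0
  | w2 => 1
  | w3 => 0
  | w4 => 1

/-- The exponent of `cos (t / 2)` in `root`. -/
noncomputable def cosExponent : ChebKind → ℝ
  | w1 => 0
  | w2 => 1
  | w3 => 1
  | w4 => 0

theorem exists_root_eq (w : ChebKind) : ∃ a : ℝ, 0 < a ∧ ∀ t,
    w.root t = a * (sin (t / 2) ^ w.sinExponent * cos (t / 2) ^ w.cosExponent) := by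
  cases w <;> simp only [root, sinExponent, cosExponent, rpow_zero, rpow_one, mul_one, one_mul]
  · exact ⟨1, one_pos, fun t => rfl⟩
  · exact ⟨2, two_pos, fun t => by rw [← mul_assoc, ← sin_two_mul]; ring_nf⟩
  · exact ⟨√2, by positivity, fun t => rfl⟩
  · exact ⟨√2, by positivity, fun t => rfl⟩

theorem jacobiWeight_cos (γ δ : ℝ) (t : ℝ) (h0 : 0 ≤ sin (t / 2)) (h1 : 0 ≤ cos (t / 2)) :
    jacobiWeight γ δ (cos t) =
      (2 : ℝ) ^ γ * 2 ^ δ * (sin (t / 2) ^ (2 * γ) * cos (t / 2) ^ (2 * δ)) := by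
  have e1 : 1 - cos t = 2 * sin (t / 2) ^ 2 := by rw [sin_sq, cos_sq]; ring_nf
  have e2 : 1 + cos t = 2 * cos (t / 2) ^ 2 := by rw [cos_sq]; ring_nf
  rw [jacobiWeight, e1, e2, mul_rpow two_pos.le (sq_nonneg _), mul_rpow two_pos.le (sq_nonneg _),
    rpow_mul h0, rpow_mul h1, rpow_two, rpow_two]
  ring

theorem sin_half_pos {t : ℝ} (ht : t ∈ Set.Ioo 0 π) : 0 < sin (t / 2) :=
  sin_pos_of_pos_of_lt_pi (by linarith [ht.1]) (by linarith [ht.1, ht.2])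

theorem cos_half_pos {t : ℝ} (ht : t ∈ Set.Ioo 0 π) : 0 < cos (t / 2) :=
  cos_pos_of_mem_Ioo ⟨by linarith [ht.1, pi_pos], by linarith [ht.2]⟩

/-- The quotient of the weight and the root, at two angles. -/
theorem jacobiWeight_mul_root_eq (w : ChebKind) (γ δ : ℝ) {s t : ℝ} (hs : s ∈ Set.Ioo 0 π)
    (ht : t ∈ Set.Ioo 0 π) :
    jacobiWeight γ δ (cos t) * w.root s =
      (sin (t / 2) / sin (s / 2)) ^ (2 * γ - w.sinExponent) *
        (cos (t / 2) / cos (s / 2)) ^ (2 * δ - w.cosExponent) *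
        (jacobiWeight γ δ (cos s) * w.root t) := by
  obtain ⟨a, ha, hr⟩ := w.exists_root_eq
  have hs0 := sin_half_pos hs
  have hs1 := cos_half_pos hs
  have ht0 := sin_half_pos ht
  have ht1 := cos_half_pos ht
  rw [jacobiWeight_cos γ δ t ht0.le ht1.le, jacobiWeight_cos γ δ s hs0.le hs1.le, hr, hr,
    div_rpow ht0.le hs0.le, div_rpow ht1.le hs1.le, rpow_sub ht0, rpow_sub hs0, rpow_sub ht1,
    rpow_sub hs1]
  field_simp

/-- Of the `root²` in the Christoffel number, one factor is spent on the polynomial at the node, and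
the polynomial at `cos t` borrows a `root t`. The leftover quotient of roots merges with the
quotient of Jacobi weights. -/
theorem vpInterp_eval_mul_jacobiWeight (w : ChebKind) {n : ℕ} (m : ℕ) (f : ℝ → ℝ) (γ δ : ℝ)
    {t : ℝ} (ht : t ∈ Set.Ioo 0 π) :
    (vpInterp w n m f).eval (cos t) * jacobiWeight γ δ (cos t) =
      ∑ k ∈ Finset.Icc 1 n, f (w.node n k) * jacobiWeight γ δ (w.node n k) * (2 *
        ((sin (t / 2) / sin (w.angle n k / 2)) ^ (2 * γ - w.sinExponent) *
        (cos (t / 2) / cos (w.angle n k / 2)) ^ (2 * δ - w.cosExponent) *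
        (w.filteredKernel n m (w.angle n k) t / (n + w.shift)))) := by
  have hpi := pi_pos
  rw [vpInterp, eval_finsetSum, Finset.sum_mul]
  refine Finset.sum_congr rfl fun k hk => ?_
  obtain ⟨hk1, hkn⟩ := Finset.mem_Icc.1 hk
  have hν := w.shift_add_pos (by omega : 0 < n)
  have hs := w.angle_mem hk
  have hrs := w.root_pos hs
  have hrt := w.root_pos ht
  have h2 : √(2 / π) * √(2 / π) = 2 / π := mul_self_sqrt (by positivity)
  have e : (vpFundamental w n m k).eval (cos t) * w.root t =
      2 / (n + w.shift) * w.root (w.angle n k) * w.filteredKernel n m (w.angle n k) t := by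
    rw [vpFundamental, w.christoffel_eq hk, eval_mul, eval_C, eval_finsetSum, filteredKernel,
      Finset.mul_sum, Finset.mul_sum, Finset.sum_mul]
    refine Finset.sum_congr rfl fun j _ => ?_
    have h3 := w.orthoPoly_eval_cos_mul_root j hs
    have h4 := w.orthoPoly_eval_cos_mul_root j ht
    rw [eval_mul, eval_C, node]
    calc _ = π / (n + w.shift) * w.root (w.angle n k) * vpFilter n m j *
          (((w.orthoPoly j).eval (cos (w.angle n k)) * w.root (w.angle n k)) *
          ((w.orthoPoly j).eval (cos t) * w.root t)) := by ring
      _ = π / (n + w.shift) * w.root (w.angle n k) * vpFilter n m j *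
          ((√(2 / π) * √(2 / π)) * (w.trig j (w.angle n k) * w.trig j t)) := by
          rw [h3, h4]; ring
      _ = _ := by rw [h2]; field_simp
  have hR := w.jacobiWeight_mul_root_eq γ δ hs ht
  rw [eval_mul, eval_C]
  refine mul_right_cancel₀ hrt.ne' ?_
  calc _ = f (w.node n k) * ((vpFundamental w n m k).eval (cos t) * w.root t) *
        jacobiWeight γ δ (cos t) := by ring
    _ = f (w.node n k) * (2 / (n + w.shift)) * w.filteredKernel n m (w.angle n k) t *
        (jacobiWeight γ δ (cos t) * w.root (w.angle n k)) := by rw [e]; ring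
    _ = _ := by rw [hR, node]; ring

theorem offset_mem (w : ChebKind) : 0 ≤ w.offset ∧ w.offset ≤ 1 / 2 := by
  cases w <;> simp only [offset] <;> norm_num

theorem half_le_shift_add_offset (w : ChebKind) : 1 / 2 ≤ w.shift + w.offset := by
  cases w <;> simp only [shift, offset] <;> norm_num

/-- By Jordan's inequality the right side is at least `k - offset`; the case `k = 1` with offset
`1/2` dictates the constant `1/4`. -/
theorem le_mul_sin_half_angle (w : ChebKind) {n k : ℕ} (hk : k ∈ Finset.Icc 1 n) :
    1 / 4 * (1 + |(k : ℝ) - ((0 : ℤ) : ℝ)|) ≤ (n + w.shift) * sin (w.angle n k / 2) := by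
  have hpi := pi_pos
  obtain ⟨hk1, hkn⟩ := Finset.mem_Icc.1 hk
  have hν := w.shift_add_pos (by omega : 0 < n)
  have hk1' : (1 : ℝ) ≤ k := by exact_mod_cast hk1
  have h := le_mul_sin_half (w.angle_mem hk)
  have ho := w.offset_mem
  have e : (n + w.shift) * w.angle n k = (k - w.offset) * π := by
    rw [angle_eq]; field_simp
  have h2 := mul_le_mul_of_nonneg_left h hν.le
  rw [e, mul_left_comm, mul_comm _ π] at h2
  have h3 := le_of_mul_le_mul_left h2 hpi
  rw [Int.cast_zero, sub_zero, abs_of_nonneg (by linarith)]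
  linarith

theorem le_mul_cos_half_angle (w : ChebKind) {n k : ℕ} (hk : k ∈ Finset.Icc 1 n) :
    1 / 4 * (1 + |(k : ℝ) - ((n + 1 : ℤ) : ℝ)|) ≤ (n + w.shift) * cos (w.angle n k / 2) := by
  have hpi := pi_pos
  obtain ⟨hk1, hkn⟩ := Finset.mem_Icc.1 hk
  have hν := w.shift_add_pos (by omega : 0 < n)
  have hkn' : (k : ℝ) ≤ n := by exact_mod_cast hkn
  have hm := w.angle_mem hk
  have h := le_mul_sin_half (t := π - w.angle n k) ⟨by linarith [hm.2], by linarith [hm.1]⟩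
  rw [sub_div, sin_pi_div_two_sub] at h
  have ho := w.half_le_shift_add_offset
  have e : (n + w.shift) * (π - w.angle n k) = π * (n + w.shift - k + w.offset) := by
    rw [angle_eq]; field_simp; ring
  have h2 := mul_le_mul_of_nonneg_left h hν.le
  rw [e, mul_left_comm] at h2
  have h3 := le_of_mul_le_mul_left h2 hpi
  push_cast
  rw [abs_of_nonpos (by linarith)]
  linarith

/-- The centre is the integer part of the fractional index `ν t / π + offset` of `t`; the summand 1
on the right pays for the rounding. -/
theorem exists_le_one_add_mul_abs_sin (w : ChebKind) {n : ℕ} (hn : 0 < n) {t : ℝ}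
    (ht : t ∈ Set.Ioo 0 π) : ∃ j : ℤ, ∀ k ∈ Finset.Icc 1 n,
      1 / 4 * (1 + |(k : ℝ) - j|) ≤ 1 + (n + w.shift) * |sin ((t - w.angle n k) / 2)| := by
  have hpi := pi_pos
  have hν := w.shift_add_pos hn
  set ν := n + w.shift with hνdef
  refine ⟨⌊ν * t / π + w.offset⌋, fun k hk => ?_⟩
  have hs := w.angle_mem hk
  have h := mul_abs_le_abs_sin (x := (t - w.angle n k) / 2)
    (by rw [abs_le]; constructor <;> linarith [hs.1, hs.2, ht.1, ht.2])
  have h2 := mul_le_mul_of_nonneg_left h hν.le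
  have e : ν * (2 / π * |(t - w.angle n k) / 2|) = |ν * t / π + w.offset - k| := by
    have e1 : ν * t / π + w.offset - k = ν * (2 / π) * ((t - w.angle n k) / 2) := by
      rw [angle_eq, ← hνdef]; field_simp; ring
    rw [e1, abs_mul, abs_of_pos (by positivity : 0 < ν * (2 / π))]; ring
  rw [e] at h2
  have h3 := Int.floor_le (ν * t / π + w.offset)
  have h4 := Int.lt_floor_add_one (ν * t / π + w.offset)
  set y := ν * t / π + w.offset
  have h5 : |(k : ℝ) - ⌊y⌋| ≤ |y - k| + 1 := by
    have := neg_abs_le (y - k)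
    have := le_abs_self (y - k)
    rw [abs_le]; constructor <;> linarith
  have := abs_nonneg (y - k)
  linarith

/-- The weighted Lebesgue function of the VP interpolation is bounded. -/
theorem exists_sum_ratio_mul_filteredKernel_le (w : ChebKind) {γ δ : ℝ}
    (h : ExponentBounds w γ δ) {c : ℝ} (hc : 0 < c) :
    ∃ C : ℝ, ∀ n m : ℕ, 0 < m → m < n → (n : ℝ) ≤ c * m → ∀ t ∈ Set.Ioo 0 π,
      ∑ k ∈ Finset.Icc 1 n,
        (sin (t / 2) / sin (w.angle n k / 2)) ^ (2 * γ - w.sinExponent) *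
        (cos (t / 2) / cos (w.angle n k / 2)) ^ (2 * δ - w.cosExponent) *
        (|w.filteredKernel n m (w.angle n k) t| / (n + w.shift)) ≤ C := by
  have hpi := pi_pos
  -- The exponent bounds are used here. The last two claims say that a negative exponent occurs only
  -- when the kernel vanishes at the corresponding endpoint.
  obtain ⟨hα, hα2, hβ, hβ2, hαβ, hβα, hαw, hβw⟩ :
      -1 < 2 * γ - w.sinExponent ∧ 2 * γ - w.sinExponent ≤ 2 ∧
      -1 < 2 * δ - w.cosExponent ∧ 2 * δ - w.cosExponent ≤ 2 ∧
      (2 * γ - w.sinExponent < 0 → 2 * δ - w.cosExponent - (2 * γ - w.sinExponent) ≤ 2) ∧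
      (2 * δ - w.cosExponent < 0 → 2 * γ - w.sinExponent - (2 * δ - w.cosExponent) ≤ 2) ∧
      (2 * γ - w.sinExponent < 0 → w = w2 ∨ w = w4) ∧
      (2 * δ - w.cosExponent < 0 → w = w2 ∨ w = w3) := by
    cases w <;> simp only [ExponentBounds] at h <;> simp only [sinExponent, cosExponent] <;>
      refine ⟨by linarith, by linarith, by linarith, by linarith, fun _ => by linarith,
        fun _ => by linarith, fun _ => ?_, fun _ => ?_⟩ <;>
      first
        | simp; done
        | exfalso; linarith
  set α := 2 * γ - w.sinExponent
  set β := 2 * δ - w.cosExponent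
  have hK : 0 ≤ 320 + 6 * c := by linarith
  obtain ⟨C₁, hC₁⟩ := exists_sum_ratio_mul_kernel_le (c := 1 / 4) hα hα2 hβ.le hβ2 hαβ
    (by norm_num) hK
  obtain ⟨C₂, hC₂⟩ := exists_sum_ratio_mul_kernel_le (c := 1 / 4) hβ hβ2 hα.le hα2 hβα
    (by norm_num) hK
  refine ⟨max C₁ C₂, fun n m hm hmn hnm t ht => ?_⟩
  have hν := w.shift_add_pos (by omega : 0 < n)
  obtain ⟨j₀, hj₀⟩ := w.exists_le_one_add_mul_abs_sin (by omega : 0 < n) ht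
  rcases le_total t (π / 2) with hle | hle
  · refine le_trans ?_ (le_max_left _ _)
    exact hC₁ (Finset.Icc 1 n) (n + w.shift) t (w.angle n)
      (fun k => w.filteredKernel n m (w.angle n k) t) j₀ 0 (n + 1) hν ⟨ht.1, hle⟩
      (fun k hk => w.angle_mem hk) hj₀ (fun k hk => w.le_mul_sin_half_angle hk)
      (fun k hk => w.le_mul_cos_half_angle hk)
      (fun k hk => w.abs_filteredKernel_mul_le hm hmn hnm (w.angle_mem hk) ht)
      (fun hα0 k hk => w.abs_filteredKernel_mul_le_sin (hαw hα0) hm hmn hnm (w.angle_mem hk) ht)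
  -- Reflection `t ↦ π - t` swaps sine with cosine, `α` with `β`, and the centres `0` and `n + 1`.
  · refine le_trans ?_ (le_max_right _ _)
    have hsin : ∀ x, sin ((π - x) / 2) = cos (x / 2) := fun x => by
      rw [sub_div, sin_pi_div_two_sub]
    have hcos : ∀ x, cos ((π - x) / 2) = sin (x / 2) := fun x => by
      rw [sub_div, cos_pi_div_two_sub]
    have hdist : ∀ x, |sin ((π - t - (π - x)) / 2)| = |sin ((t - x) / 2)| := fun x => by
      rw [show (π - t - (π - x)) / 2 = -((t - x) / 2) by ring, sin_neg, abs_neg]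
    have := hC₂ (Finset.Icc 1 n) (n + w.shift) (π - t) (fun k => π - w.angle n k)
      (fun k => w.filteredKernel n m (w.angle n k) t) j₀ (n + 1) 0 hν
      ⟨by linarith [ht.2], by linarith⟩
      (fun k hk => ⟨by linarith [(w.angle_mem hk).2], by linarith [(w.angle_mem hk).1]⟩)
    simp only [hsin, hcos, hdist] at this
    refine le_trans (le_of_eq (Finset.sum_congr rfl fun k _ => ?_)) (this hj₀
      (fun k hk => w.le_mul_cos_half_angle hk) (fun k hk => w.le_mul_sin_half_angle hk)
      (fun k hk => w.abs_filteredKernel_mul_le hm hmn hnm (w.angle_mem hk) ht)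
      (fun hβ0 k hk => w.abs_filteredKernel_mul_le_cos (hβw hβ0) hm hmn hnm (w.angle_mem hk) ht))
    ring

end ChebKind

/-! ### Uniform boundedness and the error estimate. -/

theorem continuous_jacobiWeight {γ δ : ℝ} (hγ : 0 ≤ γ) (hδ : 0 ≤ δ) :
    Continuous (jacobiWeight γ δ) := by
  unfold jacobiWeight
  exact ((continuous_const.sub continuous_id).rpow_const fun _ => .inr hγ).mul
    ((continuous_const.add continuous_id).rpow_const fun _ => .inr hδ)

/-- The VP interpolation is uniformly bounded in the weighted norm. -/
theorem exists_abs_vpInterp_mul_jacobiWeight_le (w : ChebKind) {γ δ : ℝ}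
    (h : ExponentBounds w γ δ) {c : ℝ} (hc : 0 < c) :
    ∃ C : ℝ, 0 ≤ C ∧ ∀ n m : ℕ, 0 < m → m < n → (n : ℝ) ≤ c * m → ∀ (f : ℝ → ℝ) (B : ℝ),
      (∀ x ∈ Set.Icc (-1 : ℝ) 1, |f x * jacobiWeight γ δ x| ≤ B) →
      ∀ x ∈ Set.Icc (-1 : ℝ) 1, |(vpInterp w n m f).eval x * jacobiWeight γ δ x| ≤ C * B := by
  obtain ⟨C, hC⟩ := w.exists_sum_ratio_mul_filteredKernel_le h hc
  refine ⟨2 * max C 0, by positivity, fun n m hm hmn hnm f B hB => ?_⟩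
  have hγδ : 0 ≤ γ ∧ 0 ≤ δ := by
    cases w <;> simp only [ExponentBounds] at h <;> constructor <;> linarith
  have hB0 : 0 ≤ B := (abs_nonneg _).trans (hB 0 (by norm_num))
  have hν := w.shift_add_pos (by omega : 0 < n)
  have hint : ∀ x ∈ Set.Ioo (-1 : ℝ) 1,
      |(vpInterp w n m f).eval x * jacobiWeight γ δ x| ≤ 2 * max C 0 * B := by
    intro x hx
    have ht : arccos x ∈ Set.Ioo 0 π :=
      ⟨arccos_pos.2 hx.2, lt_of_le_of_ne (arccos_le_pi x) fun e => by
        have := arccos_eq_pi.1 e; linarith [hx.1]⟩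
    rw [← cos_arccos hx.1.le hx.2.le, w.vpInterp_eval_mul_jacobiWeight m f γ δ ht]
    calc _ ≤ _ := Finset.abs_sum_le_sum_abs _ _
      _ ≤ ∑ k ∈ Finset.Icc 1 n, B * (2 *
        ((sin (arccos x / 2) / sin (w.angle n k / 2)) ^ (2 * γ - w.sinExponent) *
        (cos (arccos x / 2) / cos (w.angle n k / 2)) ^ (2 * δ - w.cosExponent) *
        (|w.filteredKernel n m (w.angle n k) (arccos x)| / (n + w.shift)))) := by
          refine Finset.sum_le_sum fun k hk => ?_
          have hs := w.angle_mem hk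
          have := ChebKind.sin_half_pos hs
          have := ChebKind.cos_half_pos hs
          have := ChebKind.sin_half_pos ht
          have := ChebKind.cos_half_pos ht
          rw [abs_mul, abs_mul 2, abs_mul (_ * _) (_ / _), abs_div, abs_two, abs_of_pos hν,
            abs_of_pos (a := _ ^ _ * _ ^ _) (by positivity)]
          gcongr
          exact hB _ ⟨neg_one_le_cos _, cos_le_one _⟩
      _ = 2 * B * ∑ k ∈ Finset.Icc 1 n,
        (sin (arccos x / 2) / sin (w.angle n k / 2)) ^ (2 * γ - w.sinExponent) *
        (cos (arccos x / 2) / cos (w.angle n k / 2)) ^ (2 * δ - w.cosExponent) *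
        (|w.filteredKernel n m (w.angle n k) (arccos x)| / (n + w.shift)) := by
          rw [Finset.mul_sum]
          exact Finset.sum_congr rfl fun k _ => by ring
      _ ≤ 2 * B * max C 0 := by
          gcongr
          exact (hC n m hm hmn hnm _ ht).trans (le_max_left _ _)
      _ = _ := by ring
  intro x hx
  -- The angular formula covers only the open interval; the endpoints follow by continuity of
  -- polynomial times weight.
  rw [← closure_Ioo (by norm_num : (-1 : ℝ) ≠ 1)] at hx
  refine le_on_closure hint (Continuous.continuousOn ?_) continuousOn_const hx
  exact ((Polynomial.continuous _).mul (continuous_jacobiWeight hγδ.1 hγδ.2)).abs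

theorem vpInterp_sub_polynomial (w : ChebKind) {n m : ℕ} (hm : 0 < m) (hmn : m < n) (f : ℝ → ℝ)
    {P : ℝ[X]} (hP : P.natDegree ≤ n - m) :
    vpInterp w n m f = vpInterp w n m (fun x => f x - P.eval x) + P := by
  have h := vpInterp_add w n m (fun x => f x - P.eval x) fun x => P.eval x
  simp only [sub_add_cancel] at h
  rw [vpInterp_eval_eq_self w hm hmn hP] at h
  exact h

/-- Lebesgue's inequality: `f - V f = (f - P) - V (f - P)` produces the constant `1 + C`. -/
theorem weightedError_vpInterp_le (w : ChebKind) {γ δ C : ℝ} (hC : 0 ≤ C) {n m : ℕ} (hm : 0 < m)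
    (hmn : m < n)
    (h : ∀ (f : ℝ → ℝ) (B : ℝ), (∀ x ∈ Set.Icc (-1 : ℝ) 1, |f x * jacobiWeight γ δ x| ≤ B) →
      ∀ x ∈ Set.Icc (-1 : ℝ) 1, |(vpInterp w n m f).eval x * jacobiWeight γ δ x| ≤ C * B)
    (f : ℝ → ℝ) {P : ℝ[X]} (hP : P.natDegree ≤ n - m) :
    weightedError γ δ f (vpInterp w n m f) ≤
      ((1 + C).toNNReal : ℝ≥0∞) * weightedError γ δ f P := by
  rcases eq_or_ne (weightedError γ δ f P) ⊤ with htop | htop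
  · have : ((1 + C).toNNReal : ℝ≥0∞) ≠ 0 := by
      rw [Ne, ENNReal.coe_eq_zero, toNNReal_eq_zero]; linarith
    rw [htop, ENNReal.mul_top this]
    exact le_top
  have hB : ∀ x ∈ Set.Icc (-1 : ℝ) 1,
      |(f x - P.eval x) * jacobiWeight γ δ x| ≤ (weightedError γ δ f P).toReal := by
    intro x hx
    rw [← ENNReal.ofReal_le_iff_le_toReal htop]
    exact le_iSup₂ (f := fun x (_ : x ∈ Set.Icc (-1 : ℝ) 1) =>
      ENNReal.ofReal |(f x - P.eval x) * jacobiWeight γ δ x|) x hx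
  refine iSup₂_le fun x hx => ?_
  have h1 := hB x hx
  have h2 := h _ _ hB x hx
  have e : ((1 + C).toNNReal : ℝ≥0∞) * weightedError γ δ f P =
      ENNReal.ofReal ((1 + C) * (weightedError γ δ f P).toReal) := by
    rw [ENNReal.ofReal_mul (by linarith), ENNReal.ofReal_toReal htop]
    rfl
  rw [e]
  refine ENNReal.ofReal_le_ofReal ?_
  rw [vpInterp_sub_polynomial w hm hmn f hP]
  simp only [eval_add]
  have e2 : (f x - ((vpInterp w n m fun x => f x - P.eval x).eval x + P.eval x)) *
      jacobiWeight γ δ x = (f x - P.eval x) * jacobiWeight γ δ x -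
      (vpInterp w n m fun x => f x - P.eval x).eval x * jacobiWeight γ δ x := by ring
  rw [e2]
  refine (abs_sub _ _).trans ?_
  linarith

theorem corollary1 (w : ChebKind) (γ δ : ℝ) (hγδ : ExponentBounds w γ δ)
    (c : ℝ) (hc : 1 < c) :
    ∃ C : ℝ≥0, 0 < C ∧ ∀ n m : ℕ, m < n → (n : ℝ) ≤ c * m →
      ∀ f : ℝ → ℝ, VanishesAtZerosOfWeight γ δ f →
        bestError γ δ f (n + m - 1) ≤ weightedError γ δ f (vpInterp w n m f) ∧
        weightedError γ δ f (vpInterp w n m f) ≤ C * bestError γ δ f (n - m) := by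
  obtain ⟨C, hC0, hC⟩ := exists_abs_vpInterp_mul_jacobiWeight_le w hγδ (by linarith : 0 < c)
  refine ⟨(1 + C).toNNReal, toNNReal_pos.2 (by linarith), fun n m hmn hnm f _ => ⟨?_, ?_⟩⟩
  · rw [bestError]
    exact iInf₂_le (f := fun (P : ℝ[X]) (_ : P.natDegree ≤ n + m - 1) => weightedError γ δ f P)
      _ (natDegree_vpInterp_le w n m f)
  -- With `m = 0` the bound `n ≤ c m` would force `n = 0`, contradicting `m < n`.
  · have hm : 0 < m := by
      rcases Nat.eq_zero_or_pos m with rfl | hm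
      · have : (0 : ℝ) < n := by exact_mod_cast hmn
        simp at hnm
        omega
      · exact hm
    have hne : ((1 + C).toNNReal : ℝ≥0∞) ≠ 0 := by
      rw [Ne, ENNReal.coe_eq_zero, toNNReal_eq_zero]; linarith
    -- A nonzero finite constant passes inside the infimum, so comparison with each single `P` is
    -- enough.
    simp only [bestError, ENNReal.mul_iInf_of_ne hne ENNReal.coe_ne_top]
    exact le_iInf₂ fun P hP => weightedError_vpInterp_le w hC0 hm hmn (hC n m hm hmn hnm) f hP
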